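/- Let $n\ge 0$ and let $B_n$ be the Coxeter group of type $B$ with generators $s_0,s_1,\dots,s_{n-1}$ and relations $s_i^2=1$, $(s_0s_1)^4=1$, $(s_is_{i+1})^3=1$ for $1\le i\le n-2$, and $(s_is_j)^2=1$ for $|i-j|\ge 2$; let $\ell$ be its Coxeter length. For $1\le k\le n$ put $\tau_k=s_0s_1\cdots s_{k-1}$. Let $\dot S_n$ be the parabolic subgroup of $B_n$ generated by $s_1,\dots,s_{n-1}$. A generalized standard OGS presentation of an element of $B_n$ is an expression of it as $\tau_1^{i_1}\tau_2^{i_2}\cdots\tau_n^{i_n}$ with $-k\le i_k<k$ for all $k$; we say that $\tau_k$ occurs in it if $i_k\neq 0$. Theorem. Every $\pi\in B_n$ has a presentation $$\pi=u_1v_1u_2v_2\cdots u_{r-1}v_{r-1}u_r\qquad(r\ge 1)$$ such that (a) $u_j\in\dot S_n$ for $1\le j\le r$; (b) $v_j=\tau_{p_j}^{p_j}$ for $1\le j\le r-1$, where $1\le p_1<p_2<\cdots<p_{r-1}\le n$; (c) each $u_j$ has a generalized standard OGS presentation in which every occurring $\tau_k$ satisfies $k\ge p_{j-1}$ (if $2\le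 j\le r$) and $k\le p_j$ (if $1\le j\le r-1$); in particular $u_j=1$ is allowed. For every such presentation, $$\ell(\pi)=\sum_{i=1}^{r-1}(-1)^{r-1-i}\bigl(\ell(v_i)-\ell(u_i)\bigr)+\ell(u_r),$$ that is, $\ell(\pi)=\ell(u_r)+\ell(v_{r-1})-\ell(u_{r-1})-\ell(v_{r-2})+\ell(u_{r-2})+\cdots+(-1)^{r-1}\ell(u_1)$. -/

import Mathlib

namespace TypeB

/-- The Coxeter matrix of type `B_n` with nodes `0, 1, …, n - 1`, the edge labelled `4` joining the
nodes `0` and `1`. Mathlib's `CoxeterMatrix.B n` has that edge at the other end, hence the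
reversal of the nodes. -/
def matrix (n : ℕ) : CoxeterMatrix (Fin n) := (CoxeterMatrix.B n).reindex Fin.revPerm

/-- The entries of the Coxeter matrix: `m(i,i) = 1`, `m(0,1) = m(1,0) = 4`, `m(i,j) = 3` for all
other pairs with `|i - j| = 1`, and `m(i,j) = 2` for `|i - j| ≥ 2`. -/
theorem matrix_apply (n : ℕ) (i j : Fin n) :
    matrix n i j =
      if (i : ℕ) = j then 1
      else if ((i : ℕ) = 0 ∧ (j : ℕ) = 1) ∨ ((i : ℕ) = 1 ∧ (j : ℕ) = 0) then 4
      else if (i : ℕ) + 1 = j ∨ (j : ℕ) + 1 = i then 3 else 2 := by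
  have hi := i.isLt
  have hj := j.isLt
  simp only [matrix, CoxeterMatrix.reindex_apply, CoxeterMatrix.B, Matrix.of_apply,
    Fin.revPerm_symm, Fin.revPerm_apply, Fin.val_rev, Fin.ext_iff]
  split_ifs <;> omega

/-- The Coxeter group `B_n`, given by its presentation. -/
abbrev Grp (n : ℕ) : Type := (matrix n).Group

/-- The Coxeter length `ℓ` on `B_n` with respect to the generators `s_0, …, s_{n-1}`. -/
noncomputable def len (n : ℕ) (w : Grp n) : ℕ := (matrix n).toCoxeterSystem.length w

/-- The Coxeter generator `s_i`, `0 ≤ i ≤ n - 1` (by convention `1` for other `i`; these values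
are never used). -/
def s (n i : ℕ) : Grp n := if h : i < n then (matrix n).simple ⟨i, h⟩ else 1

/-- `τ_k = s_0 s_1 ⋯ s_{k-1}`, for `1 ≤ k ≤ n`. -/
def tau (n k : ℕ) : Grp n := ((List.range k).map (s n)).prod

/-- The parabolic subgroup `Ṡ_n` of `B_n` generated by `s_1, …, s_{n-1}`. -/
def sDot (n : ℕ) : Subgroup (Grp n) :=
  Subgroup.closure {g | ∃ i, 1 ≤ i ∧ i < n ∧ g = s n i}

/-- `IsOGS n e w`: the exponents `e 1, …, e n` give the generalized standard OGS presentation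
`w = τ_1 ^ e 1 * τ_2 ^ e 2 * ⋯ * τ_n ^ e n` with `-k ≤ e k < k`. -/
def IsOGS (n : ℕ) (e : ℕ → ℤ) (w : Grp n) : Prop :=
  (∀ k, 1 ≤ k → k ≤ n → -(k : ℤ) ≤ e k ∧ e k < k) ∧
    w = ((List.range n).map fun k => tau n (k + 1) ^ e (k + 1)).prod

/-- `IsUVForm n r p u v w`: the element `w` of `B_n` is presented as
`w = u_1 v_1 u_2 v_2 ⋯ u_{r-1} v_{r-1} u_r`, with pieces as required by the generalized standard
OGS factorization. Only `u_1, …, u_r`, `v_1, …, v_{r-1}` and `p_1, …, p_{r-1}` matter. -/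
structure IsUVForm (n r : ℕ) (p : ℕ → ℕ) (u v : ℕ → Grp n) (w : Grp n) : Prop where
  one_le_r : 1 ≤ r
  p_mem : ∀ j, 1 ≤ j → j < r → 1 ≤ p j ∧ p j ≤ n
  p_lt : ∀ i j, 1 ≤ i → i < j → j < r → p i < p j
  v_eq : ∀ j, 1 ≤ j → j < r → v j = tau n (p j) ^ p j
  u_mem : ∀ j, 1 ≤ j → j ≤ r → u j ∈ sDot n
  /-- Every `τ_k` that occurs (with nonzero exponent) in the OGS presentation of `u_j` has
  `k ≥ p_{j-1}` if `j ≥ 2`, and `k ≤ p_j` if `j ≤ r - 1`. For `u_j = 1` this is no condition. -/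
  u_supp : ∀ j, 1 ≤ j → j ≤ r → ∃ e : ℕ → ℤ, IsOGS n e (u j) ∧
    ∀ k, 1 ≤ k → k ≤ n → e k ≠ 0 → (2 ≤ j → p (j - 1) ≤ k) ∧ (j < r → k ≤ p j)
  prod_eq : w = ((List.range (r - 1)).map fun j => u (j + 1) * v (j + 1)).prod * u r

end TypeB

namespace TypeB

/-! ### The defining relations of `B_n` -/

/-! The group acts on the integers by signed permutations, and everything is read off from this
action. Its length function counts inversions (`len_eq_inv`), so the action is faithful. Under it
`τ_k` rotates the circle `1, …, k, -1, …, -k` by one step, so `τ_p ^ p` is `-1` on `±1, …, ±p`: it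
is the longest element of `B_p`.

Two facts give the formula. For `w` in `B_p`, right multiplication by `τ_p ^ p` complements the
inversion set, so `ℓ(w τ_p^p) = ℓ(τ_p^p) - ℓ(w)` (`len_mul_tau_pow`). If `u ∈ Ṡ_n` involves only
`τ_k` with `k ≥ p`, then `u⁻¹` preserves the cyclic order of `±1, …, ±p`, since every such rotation
does. It also preserves signs, hence is increasing on `1, …, p`. Thus `u` is minimal in `B_p u`, and
`ℓ(w u) = ℓ(w) + ℓ(u)` (`len_mul_of_support_ge`). Alternating the two along `u_1 v_1 u_2 v_2 ⋯`
produces the alternating sum.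

For existence, a presentation by powers of the `τ_k` is cut into blocks. Each exponent is split so
that the current block stays correctable into `Ṡ_n` by one power of the next `τ`; a factor `τ_k ^ k`
left over closes the block (`exists_isUVPrefix`). -/

theorem s_of_lt {n i : ℕ} (h : i < n) : s n i = (matrix n).toCoxeterSystem.simple ⟨i, h⟩ := by
  rw [s, dif_pos h, CoxeterMatrix.toCoxeterSystem_simple]

theorem s_of_le {n i : ℕ} (h : n ≤ i) : s n i = 1 := by
  rw [s, dif_neg (by omega)]

@[simp] theorem s_mul_self (n i : ℕ) : s n i * s n i = 1 := by
  by_cases h : i < n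
  · rw [s_of_lt h, CoxeterSystem.simple_mul_simple_self]
  · rw [s_of_le (by omega), one_mul]

@[simp] theorem s_inv (n i : ℕ) : (s n i)⁻¹ = s n i :=
  inv_eq_of_mul_eq_one_left (s_mul_self n i)

@[simp] theorem mul_s_mul_s (n i : ℕ) (g : Grp n) : g * s n i * s n i = g := by
  rw [mul_assoc, s_mul_self, mul_one]

theorem s_mul_s_pow {n i j : ℕ} (hi : i < n) (hj : j < n) :
    (s n i * s n j) ^ matrix n ⟨i, hi⟩ ⟨j, hj⟩ = 1 := by
  rw [s_of_lt hi, s_of_lt hj, CoxeterSystem.simple_mul_simple_pow]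

theorem s_comm {n i j : ℕ} (h : i + 2 ≤ j) : s n i * s n j = s n j * s n i := by
  by_cases hj : j < n
  · have hrel := s_mul_s_pow (by omega : i < n) hj
    rw [matrix_apply, if_neg (by simp; omega), if_neg (by simp; omega),
      if_neg (by simp; omega), pow_two] at hrel
    have := eq_inv_of_mul_eq_one_left hrel
    rwa [mul_inv_rev, s_inv, s_inv] at this
  · rw [s_of_le (i := j) (by omega), mul_one, one_mul]

theorem s_comm_of_two_le {n i j : ℕ} (h : i + 2 ≤ j ∨ j + 2 ≤ i) :
    s n i * s n j = s n j * s n i :=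
  h.elim s_comm fun h => (s_comm h).symm

theorem s_braid {n i : ℕ} (hi : 1 ≤ i) (h : i + 1 < n) :
    s n i * s n (i + 1) * s n i = s n (i + 1) * s n i * s n (i + 1) := by
  have hrel := s_mul_s_pow (by omega : i < n) h
  rw [matrix_apply, if_neg (by simp), if_neg (by simp; omega), if_pos (by simp)] at hrel
  have h2 : (s n i * s n (i + 1) * s n i) * (s n (i + 1) * s n i * s n (i + 1)) = 1 := by
    rw [← hrel]; simp only [pow_succ, pow_zero, one_mul, mul_assoc]
  have := eq_inv_of_mul_eq_one_left h2
  rw [this]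
  simp only [mul_inv_rev, s_inv, mul_assoc]

theorem s_braid_zero_one {n : ℕ} (h : 1 < n) :
    s n 0 * s n 1 * s n 0 * s n 1 = s n 1 * s n 0 * s n 1 * s n 0 := by
  have hrel := s_mul_s_pow (by omega : 0 < n) h
  rw [matrix_apply, if_neg (by simp), if_pos (by simp)] at hrel
  have h2 : (s n 0 * s n 1 * s n 0 * s n 1) * (s n 0 * s n 1 * s n 0 * s n 1) = 1 := by
    rw [← hrel]; simp only [pow_succ, pow_zero, one_mul, mul_assoc]
  have := eq_inv_of_mul_eq_one_left h2
  rw [this]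
  simp only [mul_inv_rev, s_inv, mul_assoc]

theorem grp_induction_right {n : ℕ} {P : Grp n → Prop} (w : Grp n) (one : P 1)
    (mul : ∀ w i, i < n → P w → P (w * s n i)) : P w := by
  refine (matrix n).toCoxeterSystem.simple_induction_right w one fun w i hw => ?_
  have := mul w i i.isLt hw
  rwa [s_of_lt i.isLt] at this

theorem len_mul_s_le (n i : ℕ) (w : Grp n) : len n (w * s n i) ≤ len n w + 1 := by
  by_cases h : i < n
  · rw [s_of_lt h, len, len]
    refine (CoxeterSystem.length_mul_le _ _ _).trans ?_
    rw [CoxeterSystem.length_simple]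
  · rw [s_of_le (by omega), mul_one]; omega

theorem exists_descent_of_ne_one {n : ℕ} {w : Grp n} (h : w ≠ 1) :
    ∃ i < n, len n (w * s n i) < len n w := by
  obtain ⟨i, hi⟩ := (matrix n).toCoxeterSystem.exists_rightDescent_of_ne_one h
  refine ⟨i, i.isLt, ?_⟩
  rw [s_of_lt i.isLt]
  exact hi

/-! ### Signed permutations -/

/-- The underlying function of the `i`-th simple signed permutation. -/
def flipFun (i : ℕ) (z : ℤ) : ℤ :=
  if i = 0 then (if z = 1 then -1 else if z = -1 then 1 else z)
  else if z = i then i + 1 else if z = i + 1 then i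
  else if z = -i then -(i + 1) else if z = -(i + 1) then -i else z

theorem flipFun_involutive (i : ℕ) : Function.Involutive (flipFun i) := by
  intro z
  simp only [flipFun]
  split_ifs <;> first | contradiction | omega

/-- The `i`-th simple signed permutation: `0` negates `±1`, and `i ≥ 1` swaps `±i` and
`±(i + 1)`. -/
def flip (i : ℕ) : Equiv.Perm ℤ := (flipFun_involutive i).toPerm

theorem flip_apply (i : ℕ) (z : ℤ) : flip i z =
    if i = 0 then (if z = 1 then -1 else if z = -1 then 1 else z)
    else if z = i then i + 1 else if z = i + 1 then i
    else if z = -i then -(i + 1) else if z = -(i + 1) then -i else z := rfl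

theorem flip_mul_self (i : ℕ) : flip i * flip i = 1 :=
  Equiv.ext fun z => flipFun_involutive i z

theorem flip_comm {i j : ℕ} (h : i + 2 ≤ j) : flip i * flip j = flip j * flip i := by
  refine (Equiv.Perm.Disjoint.commute fun z => ?_).eq
  simp only [flip_apply]
  split_ifs <;> omega

theorem flip_braid {i : ℕ} (hi : 1 ≤ i) :
    flip i * flip (i + 1) * flip i = flip (i + 1) * flip i * flip (i + 1) := by
  ext z
  simp only [Equiv.Perm.mul_apply]
  have key : ∀ x : ℤ, x ≠ i → x ≠ i + 1 → x ≠ i + 2 → x ≠ -i → x ≠ -(i + 1) → x ≠ -(i + 2) →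
      flip i x = x ∧ flip (i + 1) x = x := by
    intro x _ _ _ _ _ _
    simp only [flip_apply]
    push_cast
    constructor <;> split_ifs <;> omega
  have e1 : flip i i = i + 1 := by rw [flip_apply]; split_ifs <;> omega
  have e2 : flip i (i + 1) = i := by rw [flip_apply]; split_ifs <;> omega
  have e3 : flip i (i + 2) = i + 2 := by rw [flip_apply]; split_ifs <;> omega
  have e4 : flip i (-i) = -(i + 1) := by rw [flip_apply]; split_ifs <;> omega
  have e5 : flip i (-(i + 1)) = -i := by rw [flip_apply]; split_ifs <;> omega
  have e6 : flip i (-(i + 2)) = -(i + 2) := by rw [flip_apply]; split_ifs <;> omega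
  have f1 : flip (i + 1) i = i := by rw [flip_apply]; push_cast; split_ifs <;> omega
  have f2 : flip (i + 1) (i + 1) = i + 2 := by rw [flip_apply]; push_cast; split_ifs <;> omega
  have f3 : flip (i + 1) (i + 2) = i + 1 := by rw [flip_apply]; push_cast; split_ifs <;> omega
  have f4 : flip (i + 1) (-i) = -i := by rw [flip_apply]; push_cast; split_ifs <;> omega
  have f5 : flip (i + 1) (-(i + 1)) = -(i + 2) := by
    rw [flip_apply]; push_cast; split_ifs <;> omega
  have f6 : flip (i + 1) (-(i + 2)) = -(i + 1) := by
    rw [flip_apply]; push_cast; split_ifs <;> omega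
  by_cases h1 : z = i
  · subst h1; rw [e1, f2, e3, f1, e1, f2]
  by_cases h2 : z = i + 1
  · subst h2; rw [e2, f1, e1, f2, e3, f3]
  by_cases h3 : z = i + 2
  · subst h3; rw [e3, f3, e2, f1]
  by_cases h4 : z = -i
  · subst h4; rw [e4, f5, e6, f4, e4, f5]
  by_cases h5 : z = -(i + 1)
  · subst h5; rw [e5, f4, e4, f5, e6, f6]
  by_cases h6 : z = -(i + 2)
  · subst h6; rw [e6, f6, e5, f4]
  · obtain ⟨k1, k2⟩ := key z h1 h2 h3 h4 h5 h6
    rw [k1, k2, k1, k2]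

theorem flip_braid_zero_one :
    flip 0 * flip 1 * flip 0 * flip 1 = flip 1 * flip 0 * flip 1 * flip 0 := by
  ext z
  simp only [Equiv.Perm.mul_apply]
  by_cases h : z = 1 ∨ z = -1 ∨ z = 2 ∨ z = -2
  · rcases h with rfl | rfl | rfl | rfl <;> simp [flip_apply]
  · have h0 : flip 0 z = z := by rw [flip_apply]; push_cast; split_ifs <;> omega
    have h1 : flip 1 z = z := by rw [flip_apply]; push_cast; split_ifs <;> omega
    rw [h0, h1, h0, h1, h0]

theorem flip_isLiftable (n : ℕ) : (matrix n).IsLiftable fun i : Fin n => flip i := by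
  have inv3 : ∀ a b : Equiv.Perm ℤ, a * a = 1 → b * b = 1 → a * b * a = b * a * b →
      (a * b) ^ 3 = 1 := by
    intro a b ha hb h
    calc (a * b) ^ 3 = (a * b * a) * (b * a * b) := by
          simp only [pow_succ, pow_zero, one_mul, mul_assoc]
      _ = (b * a * b) * (b * a * b) := by rw [h]
      _ = b * a * (b * b) * a * b := by group
      _ = b * (a * a) * b := by rw [hb]; group
      _ = 1 := by rw [ha, mul_one, hb]
  have inv4 : ∀ a b : Equiv.Perm ℤ, a * a = 1 → b * b = 1 →
      a * b * a * b = b * a * b * a → (a * b) ^ 4 = 1 := by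
    intro a b ha hb h
    calc (a * b) ^ 4 = (a * b * a * b) * (a * b * a * b) := by
          simp only [pow_succ, pow_zero, one_mul, mul_assoc]
      _ = (a * b * a * b) * (b * a * b * a) := by rw [← h]
      _ = a * b * a * (b * b) * a * b * a := by group
      _ = a * b * (a * a) * b * a := by rw [hb]; group
      _ = a * (b * b) * a := by rw [ha]; group
      _ = 1 := by rw [hb, mul_one, ha]
  have inv2 : ∀ a b : Equiv.Perm ℤ, a * a = 1 → b * b = 1 → a * b = b * a →
      (a * b) ^ 2 = 1 := by
    intro a b ha hb h
    calc (a * b) ^ 2 = (a * b) * (a * b) := pow_two _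
      _ = (a * b) * (b * a) := by rw [h]
      _ = a * (b * b) * a := by group
      _ = 1 := by rw [hb, mul_one, ha]
  intro i j
  obtain ⟨i, hi⟩ := i
  obtain ⟨j, hj⟩ := j
  rw [matrix_apply]
  dsimp only
  have hii := flip_mul_self i
  have hjj := flip_mul_self j
  split_ifs with h1 h2 h3
  · subst h1; rw [pow_one, hii]
  · apply inv4 _ _ hii hjj
    rcases h2 with ⟨rfl, rfl⟩ | ⟨rfl, rfl⟩
    · exact flip_braid_zero_one
    · exact flip_braid_zero_one.symm
  · apply inv3 _ _ hii hjj
    rcases h3 with rfl | rfl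
    · exact flip_braid (by omega)
    · exact (flip_braid (by omega)).symm
  · apply inv2 _ _ hii hjj
    rcases (by omega : i + 2 ≤ j ∨ j + 2 ≤ i) with h | h
    · exact flip_comm h
    · exact (flip_comm h).symm

/-- The action of `B_n` on `ℤ` by signed permutations. -/
noncomputable def act (n : ℕ) : Grp n →* Equiv.Perm ℤ :=
  (matrix n).toCoxeterSystem.lift ⟨fun i => flip i, flip_isLiftable n⟩

theorem act_s {n i : ℕ} (h : i < n) : act n (s n i) = flip i := by
  rw [s_of_lt h, act, CoxeterSystem.lift_apply_simple]

/-- The group of odd permutations of `ℤ` (those with `g (-z) = -g z`) that fix all `z` with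
`|z| > p`. -/
def signed (p : ℕ) : Subgroup (Equiv.Perm ℤ) where
  carrier := {g | (∀ z, g (-z) = -g z) ∧ ∀ z, (p : ℤ) < |z| → g z = z}
  one_mem' := ⟨fun _ => rfl, fun _ _ => rfl⟩
  mul_mem' := by
    rintro a b ⟨ha, ha'⟩ ⟨hb, hb'⟩
    refine ⟨fun z => ?_, fun z hz => ?_⟩
    · rw [Equiv.Perm.mul_apply, Equiv.Perm.mul_apply, hb, ha]
    · rw [Equiv.Perm.mul_apply, hb' z hz, ha' z hz]
  inv_mem' := by
    rintro a ⟨ha, ha'⟩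
    refine ⟨fun z => ?_, fun z hz => ?_⟩
    · rw [Equiv.Perm.inv_eq_iff_eq, ha, ← Equiv.Perm.mul_apply, mul_inv_cancel,
        Equiv.Perm.one_apply]
    · rw [Equiv.Perm.inv_eq_iff_eq, ha' z hz]

section signed
variable {p : ℕ} {g : Equiv.Perm ℤ}

theorem signed_neg (hg : g ∈ signed p) (z : ℤ) : g (-z) = -g z := hg.1 z

theorem signed_fix (hg : g ∈ signed p) {z : ℤ} (hz : (p : ℤ) < |z|) : g z = z := hg.2 z hz

theorem signed_zero (hg : g ∈ signed p) : g 0 = 0 := by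
  have := signed_neg hg 0
  rw [neg_zero] at this
  omega

theorem signed_ne_zero (hg : g ∈ signed p) {z : ℤ} (hz : z ≠ 0) : g z ≠ 0 := by
  rw [← signed_zero hg]
  exact fun h => hz (g.injective h)

theorem signed_abs_le (hg : g ∈ signed p) {z : ℤ} (hz : |z| ≤ p) : |g z| ≤ p := by
  by_contra h
  have h1 := signed_fix hg (not_le.mp h)
  rw [g.injective h1] at h
  exact h hz

theorem signed_mono {q : ℕ} (h : p ≤ q) : signed p ≤ signed q := fun _ hg =>
  ⟨hg.1, fun z hz => hg.2 z (by omega)⟩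

end signed

theorem flip_mem_signed {i p : ℕ} (h : i < p) : flip i ∈ signed p := by
  refine ⟨fun z => ?_, fun z hz => ?_⟩
  · simp only [flip_apply]; split_ifs <;> omega
  · rcases abs_cases z with ⟨h1, h2⟩ | ⟨h1, h2⟩ <;> simp only [flip_apply] <;> split_ifs <;> omega

theorem act_mem_signed {n : ℕ} (w : Grp n) : act n w ∈ signed n := by
  induction w using grp_induction_right with
  | one => rw [map_one]; exact one_mem _
  | mul w i hi hw => ?_
  rw [map_mul, act_s hi]
  exact mul_mem hw (flip_mem_signed hi)

/-! ### Inversions -/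

/-- Representatives of the positive roots of type `B_n`: pairs `(a, b)` with `1 ≤ b ≤ n`,
`-b ≤ a < b` and `a ≠ 0`. -/
noncomputable def posPairs (n : ℕ) : Finset (ℤ × ℤ) :=
  (Finset.Icc (-(n : ℤ)) n ×ˢ Finset.Icc 1 (n : ℤ)).filter
    fun q => -q.2 ≤ q.1 ∧ q.1 < q.2 ∧ q.1 ≠ 0

theorem mem_posPairs {n : ℕ} {q : ℤ × ℤ} :
    q ∈ posPairs n ↔ q.2 ≤ n ∧ -q.2 ≤ q.1 ∧ q.1 < q.2 ∧ q.1 ≠ 0 := by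
  simp only [posPairs, Finset.mem_filter, Finset.mem_product, Finset.mem_Icc]
  constructor
  · rintro ⟨⟨_, _, _⟩, _, _, _⟩; refine ⟨?_, ?_, ?_, ?_⟩ <;> omega
  · rintro ⟨_, _, _, _⟩; refine ⟨⟨⟨?_, ?_⟩, ?_, ?_⟩, ?_, ?_, ?_⟩ <;> omega

/-- The positive roots sent to negative ones by `g`. -/
noncomputable def invSet (n : ℕ) (g : Equiv.Perm ℤ) : Finset (ℤ × ℤ) :=
  (posPairs n).filter fun q => g q.2 < g q.1

theorem mem_invSet {n : ℕ} {g : Equiv.Perm ℤ} {q : ℤ × ℤ} :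
    q ∈ invSet n g ↔ (q.2 ≤ n ∧ -q.2 ≤ q.1 ∧ q.1 < q.2 ∧ q.1 ≠ 0) ∧ g q.2 < g q.1 := by
  rw [invSet, Finset.mem_filter, mem_posPairs]

/-- The number of inversions of a signed permutation. -/
noncomputable def inv (n : ℕ) (g : Equiv.Perm ℤ) : ℕ := (invSet n g).card

theorem inv_one (n : ℕ) : inv n 1 = 0 := by
  rw [inv, Finset.card_eq_zero, Finset.eq_empty_iff_forall_notMem]
  intro q hq
  obtain ⟨⟨_, _, _, _⟩, h⟩ := mem_invSet.mp hq
  simp only [Equiv.Perm.one_apply] at h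
  omega

/-- The pair of the `i`-th simple root. -/
def simplePair (i : ℕ) : ℤ × ℤ := (if i = 0 then -1 else i, i + 1)

/-- The action of the `i`-th simple reflection on positive roots other than the simple root. -/
def movePair (i : ℕ) (q : ℤ × ℤ) : ℤ × ℤ :=
  if (q.2 = i + 1 ∧ (q.1 = i ∨ q.1 = -i)) ∨ (i = 0 ∧ q.2 = 1) then q
  else (flip i q.1, flip i q.2)

theorem flip_flip (i : ℕ) (z : ℤ) : flip i (flip i z) = z := flipFun_involutive i z

theorem movePair_mem {n i : ℕ} (hi : i < n) {q : ℤ × ℤ} (hq : q ∈ posPairs n) :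
    movePair i q ∈ posPairs n := by
  rw [mem_posPairs] at hq ⊢
  obtain ⟨a, b⟩ := q
  obtain ⟨h1, h2, h3, h4⟩ := hq
  unfold movePair
  dsimp only at h1 h2 h3 h4 ⊢
  split_ifs with h
  · exact ⟨h1, h2, h3, h4⟩
  · simp only [flip_apply]
    refine ⟨?_, ?_, ?_, ?_⟩ <;> split_ifs <;> omega

theorem movePair_movePair {n i : ℕ} {q : ℤ × ℤ} (hq : q ∈ posPairs n) :
    movePair i (movePair i q) = q := by
  rw [mem_posPairs] at hq
  obtain ⟨a, b⟩ := q
  obtain ⟨h1, h2, h3, h4⟩ := hq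
  dsimp only at h1 h2 h3 h4
  by_cases h : (b = i + 1 ∧ (a = i ∨ a = -i)) ∨ (i = 0 ∧ b = 1)
  · have : movePair i (a, b) = (a, b) := if_pos h
    rw [this, this]
  · have e : movePair i (a, b) = (flip i a, flip i b) := if_neg h
    have h' : ¬ ((flip i b = i + 1 ∧ (flip i a = i ∨ flip i a = -i)) ∨
        (i = 0 ∧ flip i b = 1)) := by
      simp only [flip_apply]
      split_ifs <;> omega
    have e' : movePair i (flip i a, flip i b) = (flip i (flip i a), flip i (flip i b)) := if_neg h'
    rw [e, e', flip_flip, flip_flip]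

theorem movePair_eq_simplePair {n i : ℕ} {q : ℤ × ℤ} (hq : q ∈ posPairs n)
    (h : movePair i q = simplePair i) : q = simplePair i := by
  rw [← movePair_movePair (i := i) hq, h]
  unfold movePair simplePair
  rcases Nat.eq_zero_or_pos i with rfl | hi
  · simp
  · rw [if_pos (by simp [hi.ne'])]

/-- For `i ≥ 1`, the pair `(-i, i + 1)` is flipped to `(-(i + 1), i)`, which is not a normalized
pair but stands for the same root. This is why `movePair` keeps it fixed, and oddness of `g` gives
the inequality there. -/
theorem movePair_inverts {n m i : ℕ} {g : Equiv.Perm ℤ} (hg : g ∈ signed m) {q : ℤ × ℤ}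
    (hq : q ∈ posPairs n) (hne : q ≠ simplePair i) (h : g q.2 < g q.1) :
    g (flip i (movePair i q).2) < g (flip i (movePair i q).1) := by
  rw [mem_posPairs] at hq
  obtain ⟨a, b⟩ := q
  obtain ⟨h1, h2, h3, h4⟩ := hq
  dsimp only at h1 h2 h3 h4 h
  unfold movePair
  dsimp only
  split_ifs with hs
  · rcases Nat.eq_zero_or_pos i with rfl | hi
    · exfalso
      apply hne
      simp only [simplePair, if_true, Prod.mk.injEq]
      push_cast
      omega
    · simp only [simplePair, if_neg (by omega : i ≠ 0), ne_eq, Prod.mk.injEq] at hne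
      have ha : a = -i := by omega
      have hb : b = i + 1 := by omega
      subst ha hb
      have e1 : flip i (i + 1) = i := by rw [flip_apply]; split_ifs <;> omega
      have e2 : flip i (-i) = -(i + 1) := by rw [flip_apply]; split_ifs <;> omega
      dsimp only
      rw [e1, e2, signed_neg hg]
      rw [signed_neg hg] at h
      omega
  · simpa only [flip_flip] using h

theorem flip_simplePair (i : ℕ) : flip i (simplePair i).1 = (simplePair i).2 ∧
    flip i (simplePair i).2 = (simplePair i).1 := by
  rcases Nat.eq_zero_or_pos i with rfl | hi
  · simp [simplePair, flip_apply]
  · simp only [simplePair, flip_apply, if_neg hi.ne']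
    constructor <;> split_ifs <;> omega

/-- A simple reflection permutes the positive roots other than its own, so `movePair i` matches the
inversions of `g * flip i`, apart from the simple root, with those of `g`. -/
theorem inv_mul_flip {n m i : ℕ} {g : Equiv.Perm ℤ} (hg : g ∈ signed m) (hi : i < n)
    (h : g (simplePair i).1 < g (simplePair i).2) : inv n (g * flip i) = inv n g + 1 := by
  have hsp : simplePair i ∈ posPairs n := by
    rw [mem_posPairs, simplePair]
    split_ifs <;> refine ⟨?_, ?_, ?_, ?_⟩ <;> dsimp only <;> omega
  have hf : g (flip i (simplePair i).2) < g (flip i (simplePair i).1) := by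
    rwa [(flip_simplePair i).1, (flip_simplePair i).2]
  have hmem : simplePair i ∈ invSet n (g * flip i) := Finset.mem_filter.mpr ⟨hsp, hf⟩
  have hflip : (g * flip i) * flip i = g := by rw [mul_assoc, flip_mul_self, mul_one]
  have hg' : g * flip i ∈ signed (max m n) :=
    mul_mem (signed_mono (le_max_left _ _) hg) (flip_mem_signed (lt_max_of_lt_right hi))
  rw [inv, ← Finset.card_erase_add_one hmem, inv]
  congr 1
  refine Finset.card_nbij' (movePair i) (movePair i) ?_ ?_ ?_ ?_
  · intro q hq
    simp only [Finset.mem_coe, Finset.mem_erase, invSet, Finset.mem_filter] at hq ⊢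
    obtain ⟨h1, h2, h3⟩ := hq
    refine ⟨movePair_mem hi h2, ?_⟩
    have := movePair_inverts hg' h2 h1 h3
    simpa only [Equiv.Perm.mul_apply, flip_flip] using this
  · intro q hq
    simp only [Finset.mem_coe, Finset.mem_erase, invSet, Finset.mem_filter] at hq ⊢
    obtain ⟨h2, h3⟩ := hq
    have h1 : q ≠ simplePair i := by
      rintro rfl
      exact lt_asymm h h3
    exact ⟨fun hh => h1 (movePair_eq_simplePair h2 hh), movePair_mem hi h2,
      movePair_inverts hg h2 h1 h3⟩
  · intro q hq
    exact movePair_movePair (Finset.mem_filter.mp (Finset.mem_of_mem_erase hq)).1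
  · intro q hq
    exact movePair_movePair (Finset.mem_filter.mp hq).1

theorem inv_mul_flip_of_gt {n m i : ℕ} {g : Equiv.Perm ℤ} (hg : g ∈ signed m) (hi : i < n)
    (h : g (simplePair i).2 < g (simplePair i).1) : inv n (g * flip i) + 1 = inv n g := by
  have hg' : g * flip i ∈ signed (max m n) :=
    mul_mem (signed_mono (le_max_left _ _) hg) (flip_mem_signed (lt_max_of_lt_right hi))
  have e := flip_simplePair i
  rw [← inv_mul_flip hg' hi (by rwa [Equiv.Perm.mul_apply, Equiv.Perm.mul_apply, e.1, e.2]),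
    mul_assoc, flip_mul_self, mul_one]

theorem inv_mul_flip_le {n m i : ℕ} {g : Equiv.Perm ℤ} (hg : g ∈ signed m) (hi : i < n) :
    inv n (g * flip i) ≤ inv n g + 1 := by
  have hne : (simplePair i).1 ≠ (simplePair i).2 := by
    rw [simplePair]; split_ifs <;> dsimp only <;> omega
  rcases lt_or_gt_of_ne (fun h => hne (g.injective h)) with h | h
  · exact (inv_mul_flip hg hi h).le
  · have := inv_mul_flip_of_gt hg hi h
    omega

/-- Each letter of a reduced word raises the number of inversions by at most one. -/
theorem inv_act_le_len (n : ℕ) (w : Grp n) : inv n (act n w) ≤ len n w := by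
  obtain ⟨k, hk⟩ : ∃ k, len n w = k := ⟨_, rfl⟩
  induction k using Nat.strong_induction_on generalizing w with
  | _ k ih =>
    by_cases hw : w = 1
    · rw [hw, map_one, inv_one]; omega
    · obtain ⟨i, hi, hlt⟩ := exists_descent_of_ne_one hw
      have h1 := ih _ (hk ▸ hlt) _ rfl
      have h2 := inv_mul_flip_le (n := n) (act_mem_signed (w * s n i)) hi
      rw [map_mul, act_s hi, mul_assoc, flip_mul_self, mul_one] at h2
      rw [map_mul, act_s hi] at h1
      omega

/-! ### The coset chain and the length formula -/

/-- The subgroup generated by `s_0, …, s_{k-1}`. -/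
def parab (n k : ℕ) : Subgroup (Grp n) := Subgroup.closure {g | ∃ i < k, g = s n i}

theorem s_mem_parab {n k i : ℕ} (h : i < k) : s n i ∈ parab n k :=
  Subgroup.subset_closure ⟨i, h, rfl⟩

theorem act_mem_signed_of_mem_parab {n k : ℕ} {w : Grp n} (hw : w ∈ parab n k) :
    act n w ∈ signed k := by
  induction hw using Subgroup.closure_induction with
  | mem x hx =>
    obtain ⟨i, hi, rfl⟩ := hx
    by_cases hn : i < n
    · rw [act_s hn]; exact flip_mem_signed hi
    · rw [s_of_le (by omega), map_one]; exact one_mem _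
  | one => rw [map_one]; exact one_mem _
  | mul x y _ _ hx hy => rw [map_mul]; exact mul_mem hx hy
  | inv x _ hx => rw [map_inv]; exact inv_mem hx

/-- The `j`-th letter of the word `k, …, 1, 0, 1, …, k`. -/
def chainLetter (k j : ℕ) : ℕ := (k - j) + (j - k)

/-- The product of the first `j` letters of the word `s_k ⋯ s_1 s_0 s_1 ⋯ s_k`. -/
def chain (n k : ℕ) : ℕ → Grp n
  | 0 => 1
  | j + 1 => chain n k j * s n (chainLetter k j)

theorem chain_succ (n k j : ℕ) : chain n k (j + 1) = chain n k j * s n (chainLetter k j) := rfl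

/-- The prefixes of `s_k ⋯ s_1 s_0 s_1 ⋯ s_k` represent the cosets of `B_k` in `B_{k+1}`. A
generator that neither extends nor shortens the prefix is pushed through it by commutations and
braid relations, and emerges on the left in `B_k`. -/
theorem chain_mul_s {n k : ℕ} (hk : k < n) : ∀ {j i : ℕ}, j ≤ 2 * k + 1 → i ≤ k →
    i ≠ chainLetter k j → (∀ l, l + 1 = j → i ≠ chainLetter k l) →
    ∃ h ∈ parab n k, chain n k j * s n i = h * chain n k j := by
  intro j
  induction j using Nat.strong_induction_on with
  | _ j ih =>
  intro i hj hi h1 h2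
  rcases j with _ | j
  · refine ⟨s n i, s_mem_parab ?_, by simp [chain]⟩
    simp only [chainLetter] at h1
    omega
  have hl := h2 j rfl
  by_cases hc : i + 2 ≤ chainLetter k j ∨ chainLetter k j + 2 ≤ i
  · obtain ⟨h, hh, e⟩ := ih j (by omega) (by omega) hi (by omega) (by
      intro l hl
      simp only [chainLetter] at hc ⊢
      omega)
    refine ⟨h, hh, ?_⟩
    rw [chain_succ, mul_assoc, ← s_comm_of_two_le hc, ← mul_assoc, e, mul_assoc]
  · rcases j with _ | j
    · exfalso
      simp only [chainLetter] at *
      omega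
    -- The letter `i` is a neighbour of the last letter but is not the next one, so it is the one
    -- before the last.
    have hprev : i = chainLetter k j := by
      simp only [chainLetter] at *
      omega
    -- The edge labelled 4 matters only here: the prefix ends in `s_1 s_0 s_1` and is followed by
    -- `s_0`. With last letter `0`, the neighbour `1` would be the next letter, which is excluded.
    by_cases hz : chainLetter k (j + 1) = 1 ∧ i = 0
    · obtain ⟨ha, rfl⟩ := hz
      have hjk : j = k := by
        simp only [chainLetter] at *
        omega
      subst hjk
      rcases j with _ | j
      · simp only [chainLetter] at *
        omega
      obtain ⟨h, hh, e⟩ := ih j (by omega) (i := 0) (by omega) (by omega)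
        (by simp only [chainLetter]; omega) (by intro l hl; simp only [chainLetter]; omega)
      refine ⟨h, hh, ?_⟩
      have e1 : chainLetter (j + 1) j = 1 := by simp only [chainLetter]; omega
      rw [chain_succ, chain_succ, chain_succ, ha, ← hprev, e1]
      calc chain n (j + 1) j * s n 1 * s n 0 * s n 1 * s n 0
          = chain n (j + 1) j * (s n 1 * s n 0 * s n 1 * s n 0) := by simp only [mul_assoc]
        _ = chain n (j + 1) j * s n 0 * s n 1 * s n 0 * s n 1 := by
            rw [← s_braid_zero_one (by omega)]; simp only [mul_assoc]
        _ = _ := by rw [e]; simp only [mul_assoc]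
    · obtain ⟨h, hh, e⟩ := ih j (by omega) (i := chainLetter k (j + 1)) (by omega)
        (by simp only [chainLetter] at *; omega) (by simp only [chainLetter] at *; omega) (by
          intro l hl
          simp only [chainLetter] at *
          omega)
      refine ⟨h, hh, ?_⟩
      have hb : s n i * s n (chainLetter k (j + 1)) * s n i =
          s n (chainLetter k (j + 1)) * s n i * s n (chainLetter k (j + 1)) := by
        rcases (by simp only [chainLetter] at *; omega :
          (chainLetter k (j + 1) = i + 1 ∧ 1 ≤ i ∧ i + 1 < n) ∨
          (i = chainLetter k (j + 1) + 1 ∧ 1 ≤ chainLetter k (j + 1) ∧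
            chainLetter k (j + 1) + 1 < n)) with ⟨ha, hb, hc⟩ | ⟨ha, hb, hc⟩
        · rw [ha, s_braid hb hc]
        · rw [ha, s_braid hb hc]
      rw [chain_succ, chain_succ, ← hprev]
      calc chain n k j * s n i * s n (chainLetter k (j + 1)) * s n i
          = chain n k j * (s n i * s n (chainLetter k (j + 1)) * s n i) := by
            simp only [mul_assoc]
        _ = chain n k j * s n (chainLetter k (j + 1)) * s n i * s n (chainLetter k (j + 1)) := by
            rw [hb]; simp only [mul_assoc]
        _ = _ := by rw [e]; simp only [mul_assoc]

theorem exists_parab_mul_chain {n k : ℕ} (hk : k < n) {w : Grp n} (hw : w ∈ parab n (k + 1)) :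
    ∃ b ∈ parab n k, ∃ j ≤ 2 * k + 1, w = b * chain n k j := by
  have step : ∀ x : Grp n, (∃ b ∈ parab n k, ∃ j ≤ 2 * k + 1, x = b * chain n k j) →
      ∀ i ≤ k, ∃ b ∈ parab n k, ∃ j ≤ 2 * k + 1, x * s n i = b * chain n k j := by
    rintro x ⟨b, hb, j, hj, rfl⟩ i hi
    -- Right multiplication by `s_i` lengthens the prefix, shortens it, or stays in the same coset.
    by_cases h1 : j < 2 * k + 1 ∧ i = chainLetter k j
    · exact ⟨b, hb, j + 1, by omega, by rw [chain_succ, h1.2, mul_assoc]⟩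
    by_cases h2 : ∃ l, l + 1 = j ∧ i = chainLetter k l
    · obtain ⟨l, rfl, rfl⟩ := h2
      exact ⟨b, hb, l, by omega, by rw [chain_succ, ← mul_assoc, mul_s_mul_s]⟩
    · obtain ⟨h, hh, e⟩ := chain_mul_s hk hj hi
        (fun h => h1 ⟨by simp only [chainLetter] at h; omega, h⟩)
        (fun l hl h => h2 ⟨l, hl, h⟩)
      exact ⟨b * h, mul_mem hb hh, j, hj, by rw [mul_assoc, e, mul_assoc]⟩
  induction hw using Subgroup.closure_induction_right with
  | one => exact ⟨1, one_mem _, 0, by omega, by simp [chain]⟩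
  | mul_right x _ y hy hx =>
    obtain ⟨i, hi, rfl⟩ := hy
    exact step x hx i (by omega)
  | mul_inv_cancel x _ y hy hx =>
    obtain ⟨i, hi, rfl⟩ := hy
    rw [s_inv]
    exact step x hx i (by omega)

/-- The preimage of `k + 1` under `chain n k j`. -/
def chainPos (k j : ℕ) : ℤ := if j ≤ k then (k : ℤ) + 1 - j else k - j

theorem act_chain {n k : ℕ} (hk : k < n) {j : ℕ} (hj : j ≤ 2 * k + 1) :
    act n (chain n k j) (chainPos k j) = k + 1 := by
  induction j with
  | zero => simp [chain, chainPos]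
  | succ j ih =>
    have hl : chainLetter k j < n := by simp only [chainLetter]; omega
    rw [chain_succ, map_mul, act_s hl, Equiv.Perm.mul_apply]
    convert ih (by omega) using 2
    simp only [flip_apply, chainPos, chainLetter]
    push_cast
    split_ifs <;> omega

/-- Every letter of the chain creates an inversion: it moves the position of the largest value `k +
1` one step down, from `k + 1` to `1`, then to `-1` and on to `-(k + 1)`. -/
theorem inv_parab_mul_chain {n k : ℕ} (hk : k < n) {b : Grp n} (hb : b ∈ parab n k) {j : ℕ}
    (hj : j ≤ 2 * k + 1) : inv n (act n (b * chain n k j)) = inv n (act n b) + j := by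
  induction j with
  | zero => simp [chain]
  | succ j ih =>
    have hl : chainLetter k j < n := by simp only [chainLetter]; omega
    have hg : act n (b * chain n k j) ∈ signed (k + 1) := by
      rw [map_mul]
      refine mul_mem (signed_mono (by omega) (act_mem_signed_of_mem_parab hb))
        (act_mem_signed_of_mem_parab ?_)
      clear ih
      induction j with
      | zero => exact one_mem _
      | succ j ih =>
        rw [chain_succ]
        exact mul_mem (ih (by omega) (by simp only [chainLetter]; omega))
          (s_mem_parab (by simp only [chainLetter]; omega))
    have hpos : act n (b * chain n k j) (chainPos k j) = k + 1 := by
      rw [map_mul, Equiv.Perm.mul_apply, act_chain hk (by omega)]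
      refine signed_fix (act_mem_signed_of_mem_parab hb) ?_
      rw [abs_of_pos] <;> omega
    rw [chain_succ, ← mul_assoc, map_mul _ _ (s n _), act_s hl, inv_mul_flip hg hl,
      ih (by omega), add_assoc]
    generalize act n (b * chain n k j) = g at *
    have bound : ∀ z : ℤ, |z| ≤ k + 1 → z ≠ chainPos k j → g z < k + 1 := by
      intro z hz hne
      have h1 := signed_abs_le hg (z := z) (by push_cast; exact hz)
      have h2 : g z ≠ k + 1 := fun h => hne (g.injective (h.trans hpos.symm))
      have := le_abs_self (g z)
      push_cast at h1
      omega
    -- Before the sign change the second entry of the simple pair carries the largest value `k + 1`;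
    -- afterwards the first entry carries the smallest value `-(k + 1)`.
    by_cases hjk : j ≤ k
    · have e : (simplePair (chainLetter k j)).2 = chainPos k j := by
        simp only [simplePair, chainPos, chainLetter]
        rw [if_pos hjk]
        omega
      rw [e, hpos]
      apply bound
      · simp only [simplePair, chainLetter]
        rw [abs_le]
        split_ifs <;> push_cast <;> omega
      · simp only [simplePair, chainPos, chainLetter]
        split_ifs <;> push_cast <;> omega
    · have e : (simplePair (chainLetter k j)).1 = -chainPos k j := by
        simp only [simplePair, chainPos, chainLetter]
        split_ifs <;> push_cast <;> omega
      rw [e, signed_neg hg, hpos]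
      have hz : g (-(simplePair (chainLetter k j)).2) < k + 1 := by
        apply bound
        · simp only [simplePair, chainLetter]
          rw [abs_le]
          omega
        · simp only [simplePair, chainPos, chainLetter]
          rw [if_neg hjk]
          omega
      rw [signed_neg hg] at hz
      omega

/-- Descending through the cosets writes `w` as a product of chain prefixes, a word with exactly as
many letters as `w` has inversions. -/
theorem len_le_inv_of_mem_parab {n k : ℕ} (hk : k ≤ n) {w : Grp n} (hw : w ∈ parab n k) :
    len n w ≤ inv n (act n w) := by
  induction k generalizing w with
  | zero =>
    have : parab n 0 = ⊥ := by
      rw [parab, Subgroup.closure_eq_bot_iff]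
      rintro x ⟨i, hi, _⟩
      omega
    rw [this, Subgroup.mem_bot] at hw
    rw [hw, len, CoxeterSystem.length_one]
    exact Nat.zero_le _
  | succ k ih =>
    obtain ⟨b, hb, j, hj, rfl⟩ := exists_parab_mul_chain (by omega) hw
    rw [inv_parab_mul_chain (by omega) hb hj]
    have h1 := ih (by omega) hb
    have h2 : len n (b * chain n k j) ≤ len n b + j := by
      clear hj hw
      induction j with
      | zero => simp [chain]
      | succ j ih' =>
        rw [chain_succ, ← mul_assoc]
        have := len_mul_s_le n (chainLetter k j) (b * chain n k j)
        omega
    omega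

theorem mem_parab_top {n : ℕ} (w : Grp n) : w ∈ parab n n := by
  induction w using grp_induction_right with
  | one => exact one_mem _
  | mul w i hi hw => exact mul_mem hw (s_mem_parab hi)

/-- The Coxeter length is the number of inversions. -/
theorem len_eq_inv (n : ℕ) (w : Grp n) : len n w = inv n (act n w) :=
  le_antisymm (len_le_inv_of_mem_parab le_rfl (mem_parab_top w)) (inv_act_le_len n w)

/-- The action by signed permutations is faithful. -/
theorem act_injective (n : ℕ) : Function.Injective (act n) := by
  rw [injective_iff_map_eq_one]
  intro w hw
  have : len n w = 0 := by rw [len_eq_inv, hw, inv_one]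
  exact (CoxeterSystem.length_eq_zero_iff _).mp this

/-! ### Additivity of the length -/

theorem invSet_eq_of_mem_signed {n p : ℕ} (h : p ≤ n) {g : Equiv.Perm ℤ} (hg : g ∈ signed p) :
    invSet n g = invSet p g := by
  ext ⟨a, b⟩
  simp only [mem_invSet]
  constructor
  · rintro ⟨⟨h1, h2, h3, h4⟩, h5⟩
    refine ⟨⟨?_, h2, h3, h4⟩, h5⟩
    by_contra hb
    rw [signed_fix hg (z := b) (by rw [lt_abs]; omega)] at h5
    by_cases ha : |a| ≤ p
    · have := (abs_le.mp (signed_abs_le hg ha)).2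
      omega
    · rw [signed_fix hg (not_le.mp ha)] at h5
      omega
  · rintro ⟨⟨h1, h2, h3, h4⟩, h5⟩
    exact ⟨⟨by omega, h2, h3, h4⟩, h5⟩

/-- Multiplication by the longest element of `B_p` complements the set of inversions. -/
theorem inv_mul_add_inv {n p : ℕ} (h : p ≤ n) {g v : Equiv.Perm ℤ} (hg : g ∈ signed p)
    (hv : v ∈ signed p) (hneg : ∀ z : ℤ, |z| ≤ p → v z = -z) :
    inv n (g * v) + inv n g = (posPairs p).card := by
  rw [inv, inv, invSet_eq_of_mem_signed h (mul_mem hg hv), invSet_eq_of_mem_signed h hg,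
    ← Finset.card_filter_add_card_filter_not (s := posPairs p) fun q => g q.2 < g q.1, add_comm]
  congr 2
  refine Finset.filter_congr fun q hq => ?_
  obtain ⟨h1, h2, h3, h4⟩ := mem_posPairs.mp hq
  rw [Equiv.Perm.mul_apply, Equiv.Perm.mul_apply, hneg _ (by rw [abs_le]; omega),
    hneg _ (by rw [abs_le]; omega), signed_neg hg, signed_neg hg]
  have : g q.1 ≠ g q.2 := fun e => by
    have := g.injective e
    omega
  omega

theorem inv_mul_eq {n p : ℕ} (h : p ≤ n) {g v : Equiv.Perm ℤ} (hg : g ∈ signed p)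
    (hv : v ∈ signed p) (hneg : ∀ z : ℤ, |z| ≤ p → v z = -z) :
    inv n (g * v) + inv n g = inv n v := by
  have h1 := inv_mul_add_inv h (one_mem (signed p)) hv hneg
  rw [one_mul, inv_one] at h1
  rw [inv_mul_add_inv h hg hv hneg]
  omega

/-- The interval `[-p, p]` is mapped to itself and all other points are fixed, so only comparisons
inside the interval can change. -/
theorem signed_lt_iff {p : ℕ} {g : Equiv.Perm ℤ} (hg : g ∈ signed p) {a b : ℤ}
    (h : ¬ (|a| ≤ p ∧ |b| ≤ p)) : g a < g b ↔ a < b := by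
  by_cases ha : |a| ≤ p
  · have hb : ¬ |b| ≤ p := fun hb => h ⟨ha, hb⟩
    rw [signed_fix hg (not_le.mp hb)]
    have := abs_le.mp (signed_abs_le hg ha)
    rw [abs_le] at ha hb
    omega
  · rw [signed_fix hg (not_le.mp ha)]
    by_cases hb : |b| ≤ p
    · have := abs_le.mp (signed_abs_le hg hb)
      rw [abs_le] at ha hb
      omega
    · rw [signed_fix hg (not_le.mp hb)]

/-- If `u` is a minimal representative of its coset `B_p u`, then lengths add up. -/
theorem inv_mul_of_minimal {n p : ℕ} (h : p ≤ n) {g u : Equiv.Perm ℤ} (hg : g ∈ signed p)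
    (hu : u ∈ signed n) (hpos : ∀ a : ℤ, 0 < a → a ≤ p → 0 < u⁻¹ a)
    (hlt : ∀ a b : ℤ, 0 < a → a < b → b ≤ p → u⁻¹ a < u⁻¹ b) :
    inv n (g * u) = inv n g + inv n u := by
  have hu' := inv_mem hu
  have hmono : ∀ a b : ℤ, |a| ≤ p → |b| ≤ p → a < b → u⁻¹ a < u⁻¹ b := by
    intro a b ha hb hab
    rw [abs_le] at ha hb
    have hnn : ∀ c : ℤ, 0 ≤ c → c ≤ p → 0 ≤ u⁻¹ c := by
      intro c hc hcp
      rcases hc.eq_or_lt with rfl | hc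
      · rw [signed_zero hu']
      · exact (hpos c hc hcp).le
    have hneg : ∀ c : ℤ, u⁻¹ c = -u⁻¹ (-c) := fun c => by rw [signed_neg hu', neg_neg]
    rcases lt_trichotomy a 0 with h1 | rfl | h1
    · have h2 := hpos (-a) (by omega) (by omega)
      rw [hneg a]
      rcases le_or_gt 0 b with h3 | h3
      · have := hnn b h3 hb.2
        omega
      · have := hlt (-b) (-a) (by omega) (by omega) (by omega)
        rw [hneg b]
        omega
    · rw [signed_zero hu']
      exact hpos b hab hb.2
    · exact hlt a b h1 hab hb.2
  have hmono' : ∀ a b : ℤ, |u a| ≤ p → |u b| ≤ p → a < b → u a < u b := by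
    intro a b ha hb hab
    by_contra hcon
    rcases (not_lt.mp hcon).eq_or_lt with e | e
    · have := u.injective e
      omega
    · have := hmono _ _ hb ha e
      rw [← Equiv.Perm.mul_apply, ← Equiv.Perm.mul_apply, inv_mul_cancel] at this
      simp only [Equiv.Perm.one_apply] at this
      omega
  have huu : ∀ z, u⁻¹ (u z) = z := fun z => by
    rw [← Equiv.Perm.mul_apply, inv_mul_cancel, Equiv.Perm.one_apply]
  have huu' : ∀ z, u (u⁻¹ z) = z := fun z => by
    rw [← Equiv.Perm.mul_apply, mul_inv_cancel, Equiv.Perm.one_apply]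
  have hzero : ∀ z, u z = 0 ↔ z = 0 := fun z => by
    rw [← signed_zero hu, u.injective.eq_iff, signed_zero hu]
  -- Since `u` is an increasing bijection between the preimage of `[-p, p]` and that interval, it
  -- carries these inversions to those of `g`.
  have e1 : ((invSet n (g * u)).filter fun q => |u q.1| ≤ p ∧ |u q.2| ≤ p).card = inv n g := by
    rw [inv, invSet_eq_of_mem_signed h hg]
    refine Finset.card_nbij' (fun q => (u q.1, u q.2)) (fun q => (u⁻¹ q.1, u⁻¹ q.2)) ?_ ?_ ?_ ?_
    · rintro ⟨a, b⟩ hq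
      simp only [Finset.mem_coe, Finset.mem_filter, mem_invSet, Equiv.Perm.mul_apply] at hq ⊢
      obtain ⟨⟨⟨h1, h2, h3, h4⟩, h5⟩, h6, h7⟩ := hq
      have h8 := hmono' a b h6 h7 h3
      have h9 : -u b ≤ u a := by
        rcases h2.eq_or_lt with e | e
        · rw [← e, signed_neg hu]
        · have := hmono' (-b) a (by rw [signed_neg hu, abs_neg]; exact h7) h6 e
          rw [signed_neg hu] at this
          exact this.le
      exact ⟨⟨(abs_le.mp h7).2, h9, h8, fun e => h4 ((hzero a).mp e)⟩, h5⟩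
    · rintro ⟨a, b⟩ hq
      simp only [Finset.mem_coe, Finset.mem_filter, mem_invSet, Equiv.Perm.mul_apply,
        huu'] at hq ⊢
      obtain ⟨⟨h1, h2, h3, h4⟩, h5⟩ := hq
      have ha : |a| ≤ p := by rw [abs_le]; omega
      have hb : |b| ≤ p := by rw [abs_le]; omega
      have h8 := hmono a b ha hb h3
      have h9 : -u⁻¹ b ≤ u⁻¹ a := by
        rcases h2.eq_or_lt with e | e
        · rw [← e, signed_neg hu']
        · have := hmono (-b) a (by rw [abs_neg]; exact hb) ha e
          rw [signed_neg hu'] at this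
          exact this.le
      have h10 := (abs_le.mp (signed_abs_le hu' (z := b) (hb.trans (by omega)))).2
      exact ⟨⟨⟨h10, h9, h8, signed_ne_zero hu' h4⟩, h5⟩, ha, hb⟩
    · rintro ⟨a, b⟩ _
      simp only [huu]
    · rintro ⟨a, b⟩ _
      simp only [huu']
  -- On the remaining pairs `g` does not affect the comparison, and `u` has no inversion with both
  -- images in `[-p, p]`.
  have e2 : ((invSet n (g * u)).filter fun q => ¬ (|u q.1| ≤ p ∧ |u q.2| ≤ p)) = invSet n u := by
    ext ⟨a, b⟩
    simp only [Finset.mem_filter, mem_invSet, Equiv.Perm.mul_apply]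
    constructor
    · rintro ⟨⟨h1, h2⟩, h3⟩
      exact ⟨h1, (signed_lt_iff hg fun hh => h3 ⟨hh.2, hh.1⟩).mp h2⟩
    · rintro ⟨h1, h2⟩
      have h3 : ¬ (|u a| ≤ p ∧ |u b| ≤ p) := fun hh =>
        lt_asymm h2 (hmono' a b hh.1 hh.2 h1.2.2.1)
      exact ⟨⟨h1, (signed_lt_iff hg fun hh => h3 ⟨hh.2, hh.1⟩).mpr h2⟩, h3⟩
  rw [← e1, inv, ← Finset.card_filter_add_card_filter_not (s := invSet n (g * u))
    fun q => |u q.1| ≤ p ∧ |u q.2| ≤ p, e2, ← inv]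

/-! ### The elements `τ_k` -/

theorem tau_zero (n : ℕ) : tau n 0 = 1 := rfl

theorem tau_succ (n k : ℕ) : tau n (k + 1) = tau n k * s n k := by
  simp [tau, List.range_succ]

theorem tau_mem_parab (n k : ℕ) : tau n k ∈ parab n k := by
  refine Subgroup.list_prod_mem _ fun x hx => ?_
  obtain ⟨i, hi, rfl⟩ := List.mem_map.mp hx
  exact s_mem_parab (List.mem_range.mp hi)

theorem act_tau_mem_signed (n k : ℕ) : act n (tau n k) ∈ signed k :=
  act_mem_signed_of_mem_parab (tau_mem_parab n k)

theorem act_tau {n k : ℕ} (h1 : 1 ≤ k) (h2 : k ≤ n) {z : ℤ} (hz : 0 < z) (hzk : z ≤ k) :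
    act n (tau n k) z = if z = k then -1 else z + 1 := by
  induction k, h1 using Nat.le_induction generalizing z with
  | base =>
    rw [tau_succ, tau_zero, one_mul, act_s (by omega), flip_apply]
    push_cast at *
    split_ifs <;> omega
  | succ k hk ih =>
    rw [tau_succ, map_mul, Equiv.Perm.mul_apply, act_s (by omega)]
    by_cases hz1 : z = k + 1
    · have e : flip k z = k := by rw [flip_apply]; split_ifs <;> omega
      rw [e, ih (by omega) (by omega) le_rfl, if_pos rfl, if_pos (by push_cast; omega)]
    by_cases hz2 : z = k
    · have e : flip k z = k + 1 := by rw [flip_apply]; split_ifs <;> omega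
      rw [e, signed_fix (act_tau_mem_signed n k) (by rw [lt_abs]; omega),
        if_neg (by push_cast; omega), hz2]
    · have e : flip k z = z := by rw [flip_apply]; split_ifs <;> omega
      push_cast at hzk
      rw [e, ih (by omega) hz (by omega), if_neg hz2, if_neg (by push_cast; omega)]

theorem act_tau_pow {n k : ℕ} (h1 : 1 ≤ k) (h2 : k ≤ n) {c : ℕ} (hc : c ≤ k) {z : ℤ}
    (hz : 0 < z) (hzk : z ≤ k) :
    act n (tau n k ^ c) z = if z + c ≤ k then z + c else k - z - c := by
  induction c with
  | zero =>
    rw [if_pos (by push_cast; omega)]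
    simp
  | succ c ih =>
    rw [pow_succ', map_mul, Equiv.Perm.mul_apply, ih (by omega)]
    push_cast
    by_cases h : z + c ≤ k
    · rw [if_pos h, act_tau h1 h2 (by omega) h]
      split_ifs <;> omega
    · rw [if_neg h, ← neg_neg (k - z - c : ℤ), signed_neg (act_tau_mem_signed n k),
        act_tau h1 h2 (by omega) (by omega)]
      split_ifs <;> omega

theorem act_tau_pow_self {n k : ℕ} (h2 : k ≤ n) {z : ℤ} (hz : |z| ≤ k) :
    act n (tau n k ^ k) z = -z := by
  have hs : act n (tau n k ^ k) ∈ signed k := by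
    rw [map_pow]; exact pow_mem (act_tau_mem_signed n k) _
  rw [abs_le] at hz
  have hpos : ∀ x : ℤ, 0 < x → x ≤ k → act n (tau n k ^ k) x = -x := by
    intro x hx hxk
    rw [act_tau_pow (by omega) h2 le_rfl hx hxk, if_neg (by omega)]
    omega
  rcases lt_trichotomy z 0 with h | rfl | h
  · have := hpos (-z) (by omega) (by omega)
    rw [signed_neg hs] at this
    omega
  · rw [signed_zero hs, neg_zero]
  · exact hpos z h hz.2

theorem tau_pow_two_mul {n k : ℕ} (h2 : k ≤ n) : tau n k ^ (2 * k) = 1 := by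
  apply act_injective n
  rw [map_one, two_mul, pow_add, map_mul]
  have hs : act n (tau n k ^ k) ∈ signed k := by
    rw [map_pow]; exact pow_mem (act_tau_mem_signed n k) _
  ext z
  rw [Equiv.Perm.mul_apply, Equiv.Perm.one_apply]
  by_cases hz : |z| ≤ k
  · rw [act_tau_pow_self h2 hz, signed_neg hs, act_tau_pow_self h2 hz, neg_neg]
  · rw [signed_fix hs (not_le.mp hz), signed_fix hs (not_le.mp hz)]

/-! ### The subgroup `Ṡ_n` -/

theorem act_pos_of_mem_sDot {n : ℕ} {w : Grp n} (hw : w ∈ sDot n) {z : ℤ} (hz : 0 < z) :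
    0 < act n w z := by
  have hflip : ∀ i, 1 ≤ i → ∀ z : ℤ, 0 < z → 0 < flip i z := by
    intro i hi z hz
    rw [flip_apply]
    split_ifs <;> omega
  induction hw using Subgroup.closure_induction_right generalizing z with
  | one => rwa [map_one]
  | mul_right x _ y hy hx =>
    obtain ⟨i, hi, hin, rfl⟩ := hy
    rw [map_mul, Equiv.Perm.mul_apply, act_s hin]
    exact hx (hflip i hi z hz)
  | mul_inv_cancel x _ y hy hx =>
    obtain ⟨i, hi, hin, rfl⟩ := hy
    rw [s_inv, map_mul, Equiv.Perm.mul_apply, act_s hin]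
    exact hx (hflip i hi z hz)

/-- Induction on the length: `s_0` is not a descent, because `w(-1) < 0 < w(1)`, so some `s_i` with
`i ≥ 1` can be split off without losing positivity. -/
theorem mem_sDot_of_act_pos {n : ℕ} {w : Grp n} (hw : ∀ z : ℤ, 0 < z → 0 < act n w z) :
    w ∈ sDot n := by
  obtain ⟨k, hk⟩ : ∃ k, len n w = k := ⟨_, rfl⟩
  induction k using Nat.strong_induction_on generalizing w with
  | _ k ih =>
    by_cases h1 : w = 1
    · rw [h1]; exact one_mem _
    obtain ⟨i, hi, hlt⟩ := exists_descent_of_ne_one h1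
    rcases Nat.eq_zero_or_pos i with rfl | hi0
    · exfalso
      rw [len_eq_inv, len_eq_inv, map_mul, act_s hi, inv_mul_flip (act_mem_signed w) hi] at hlt
      · omega
      · have := hw 1 one_pos
        simp only [simplePair, if_true]
        rw [signed_neg (act_mem_signed w)]
        push_cast
        omega
    · have hs : s n i ∈ sDot n := Subgroup.subset_closure ⟨i, hi0, hi, rfl⟩
      have := ih _ (hk ▸ hlt) (w := w * s n i) (fun z hz => by
        rw [map_mul, Equiv.Perm.mul_apply, act_s hi]
        apply hw
        rw [flip_apply]
        split_ifs <;> omega) rfl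
      have h2 := mul_mem this hs
      rwa [mul_s_mul_s] at h2

/-- Both `τ_k ^ c` and `τ_{k+1} ^ c` send positive integers to exactly the negative values `-1, …,
-c`, so the quotient preserves positivity. -/
theorem tau_zpow_neg_mul_mem_sDot {n k : ℕ} (h2 : k + 1 ≤ n) {c : ℕ} (hc : c ≤ k) :
    (tau n k ^ c)⁻¹ * tau n (k + 1) ^ c ∈ sDot n := by
  rcases Nat.eq_zero_or_pos c with rfl | hc0
  · simp
  refine mem_sDot_of_act_pos fun z hz => ?_
  rw [map_mul, Equiv.Perm.mul_apply, map_inv]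
  have hs : act n (tau n k ^ c) ∈ signed k := by
    rw [map_pow]; exact pow_mem (act_tau_mem_signed n k) _
  have hs' : act n (tau n (k + 1) ^ c) ∈ signed (k + 1) := by
    rw [map_pow]; exact pow_mem (act_tau_mem_signed n _) _
  have key : ∀ y x : ℤ, 0 < x → act n (tau n k ^ c) x = y → 0 < (act n (tau n k ^ c))⁻¹ y := by
    rintro y x hx rfl
    rwa [← Equiv.Perm.mul_apply, inv_mul_cancel]
  by_cases hz1 : z ≤ k + 1
  · rw [act_tau_pow (by omega) h2 (by omega) hz (by push_cast; exact hz1)]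
    push_cast
    split_ifs with h
    · by_cases h3 : z + c = k + 1
      · apply key _ (k + 1) (by omega)
        rw [signed_fix hs (by rw [lt_abs]; omega), h3]
      · apply key _ z hz
        rw [act_tau_pow (by omega) (by omega) hc hz (by omega), if_pos (by omega)]
    · apply key _ (z - 1) (by omega)
      rw [act_tau_pow (by omega) (by omega) hc (by omega) (by omega), if_neg (by omega)]
      omega
  · rw [signed_fix hs' (by rw [lt_abs]; push_cast; omega)]
    apply key _ z hz
    rw [signed_fix hs (by rw [lt_abs]; omega)]

/-! ### The cyclic order -/

/-- The points `x, y, -x, -y` are in this cyclic order on the circle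
`1, 2, …, k, -1, -2, …, -k`, for any `k ≥ |x|, |y|`. -/
def Circ (x y : ℤ) : Prop :=
  (0 < x ∧ (x < y ∨ (-x < y ∧ y < 0))) ∨ (x < 0 ∧ (y < x ∨ (0 < y ∧ y < -x)))

/-- The signed permutations of `±1, …, ±k` that preserve the cyclic order. -/
def circSub (k : ℕ) : Subgroup (Equiv.Perm ℤ) where
  carrier := {g | g ∈ signed k ∧
    ∀ x y : ℤ, |x| ≤ k → |y| ≤ k → (Circ (g x) (g y) ↔ Circ x y)}
  one_mem' := ⟨one_mem _, fun _ _ _ _ => Iff.rfl⟩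
  mul_mem' := by
    rintro a b ⟨ha, ha'⟩ ⟨hb, hb'⟩
    refine ⟨mul_mem ha hb, fun x y hx hy => ?_⟩
    rw [Equiv.Perm.mul_apply, Equiv.Perm.mul_apply,
      ha' _ _ (signed_abs_le hb hx) (signed_abs_le hb hy), hb' x y hx hy]
  inv_mem' := by
    rintro a ⟨ha, ha'⟩
    refine ⟨inv_mem ha, fun x y hx hy => ?_⟩
    rw [← ha' _ _ (signed_abs_le (inv_mem ha) hx) (signed_abs_le (inv_mem ha) hy),
      ← Equiv.Perm.mul_apply, ← Equiv.Perm.mul_apply, mul_inv_cancel, Equiv.Perm.one_apply,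
      Equiv.Perm.one_apply]

theorem act_tau_mem_circSub {n k : ℕ} (h1 : 1 ≤ k) (h2 : k ≤ n) :
    act n (tau n k) ∈ circSub k := by
  have hs := act_tau_mem_signed n k
  refine ⟨hs, fun x y hx hy => ?_⟩
  have hval : ∀ z : ℤ, |z| ≤ k → act n (tau n k) z =
      if z = 0 then 0 else if 0 < z then (if z = k then -1 else z + 1)
      else if z = -k then 1 else z - 1 := by
    intro z hz
    rw [abs_le] at hz
    split_ifs with h3 h4 h5 h6
    · rw [h3, signed_zero hs]
    · rw [act_tau h1 h2 h4 hz.2, if_pos h5]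
    · rw [act_tau h1 h2 h4 hz.2, if_neg h5]
    · rw [h6, signed_neg hs, act_tau h1 h2 (by omega) le_rfl, if_pos rfl, neg_neg]
    · rw [← neg_neg z, signed_neg hs, act_tau h1 h2 (by omega) (by omega), if_neg (by omega)]
      omega
  rw [hval x hx, hval y hy]
  rw [abs_le] at hx hy
  unfold Circ
  split_ifs <;> omega

/-! ### Products of powers of the `τ_k` -/

/-- The product `τ_1 ^ e 1 * ⋯ * τ_m ^ e m`. -/
def ogsProd (n : ℕ) (e : ℕ → ℤ) (m : ℕ) : Grp n :=
  ((List.range m).map fun k => tau n (k + 1) ^ e (k + 1)).prod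

theorem ogsProd_zero (n : ℕ) (e : ℕ → ℤ) : ogsProd n e 0 = 1 := rfl

theorem ogsProd_succ (n : ℕ) (e : ℕ → ℤ) (m : ℕ) :
    ogsProd n e (m + 1) = ogsProd n e m * tau n (m + 1) ^ e (m + 1) := by
  simp [ogsProd, List.range_succ]

theorem ogsProd_congr (n : ℕ) {e f : ℕ → ℤ} {m : ℕ} (h : ∀ k, 1 ≤ k → k ≤ m → e k = f k) :
    ogsProd n e m = ogsProd n f m := by
  induction m with
  | zero => rfl
  | succ m ih =>
    rw [ogsProd_succ, ogsProd_succ, ih fun k h1 h2 => h k h1 (by omega),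
      h (m + 1) (by omega) le_rfl]

theorem ogsProd_eq_of_le (n : ℕ) {e : ℕ → ℤ} {m m' : ℕ} (hm : m ≤ m')
    (h : ∀ k, m < k → k ≤ m' → e k = 0) : ogsProd n e m' = ogsProd n e m := by
  induction m', hm using Nat.le_induction with
  | base => rfl
  | succ m' hm ih =>
    rw [ogsProd_succ, ih fun k h1 h2 => h k h1 (by omega), h (m' + 1) (by omega) le_rfl,
      zpow_zero, mul_one]

theorem ogsProd_eq_one (n : ℕ) {e : ℕ → ℤ} {m : ℕ} (h : ∀ k, 1 ≤ k → k ≤ m → e k = 0) :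
    ogsProd n e m = 1 := by
  rw [ogsProd_eq_of_le n (Nat.zero_le m) fun k h1 h2 => h k h1 h2, ogsProd_zero]

theorem act_ogsProd_mem_signed {n q m : ℕ} {e : ℕ → ℤ}
    (h : ∀ k, 1 ≤ k → k ≤ m → e k ≠ 0 → k ≤ q) : act n (ogsProd n e m) ∈ signed q := by
  induction m with
  | zero => rw [ogsProd_zero, map_one]; exact one_mem _
  | succ m ih =>
    rw [ogsProd_succ, map_mul, map_zpow]
    refine mul_mem (ih fun k h1 h2 h3 => h k h1 (by omega) h3) ?_
    by_cases he : e (m + 1) = 0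
    · rw [he, zpow_zero]; exact one_mem _
    · exact zpow_mem (signed_mono (h _ (by omega) le_rfl he) (act_tau_mem_signed n _)) _

/-- `Circ` does not depend on the size of the circle, so rotations of circles of different sizes `k
≥ p` can be composed. -/
theorem circ_ogsProd_inv {n p m : ℕ} (hm : m ≤ n) {e : ℕ → ℤ}
    (h : ∀ k, 1 ≤ k → k ≤ m → e k ≠ 0 → p ≤ k) {x y : ℤ} (hx : |x| ≤ p) (hy : |y| ≤ p)
    (hc : Circ x y) : Circ ((act n (ogsProd n e m))⁻¹ x) ((act n (ogsProd n e m))⁻¹ y) := by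
  induction m with
  | zero => rw [ogsProd_zero, map_one]; simpa using hc
  | succ m ih =>
    have ih' := ih (by omega) fun k h1 h2 h3 => h k h1 (by omega) h3
    rw [ogsProd_succ, map_mul, map_zpow, mul_inv_rev, Equiv.Perm.mul_apply, Equiv.Perm.mul_apply]
    by_cases he : e (m + 1) = 0
    · rw [he, zpow_zero]; simpa using ih'
    · have hp := h _ (by omega) le_rfl he
      have hs : (act n (ogsProd n e m))⁻¹ ∈ signed (m + 1) :=
        inv_mem (act_ogsProd_mem_signed fun k h1 h2 _ => by omega)
      refine ((inv_mem (zpow_mem (act_tau_mem_circSub (by omega) hm) (e (m + 1)))).2 _ _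
        (signed_abs_le hs ?_) (signed_abs_le hs ?_)).mpr ih'
      · exact hx.trans (by exact_mod_cast hp)
      · exact hy.trans (by exact_mod_cast hp)

/-! ### The length formula for the factorization -/

/-- For positive arguments `Circ` is just `<`. As `u⁻¹` preserves positivity, preserving the cyclic
order makes it increasing on `1, …, p`. -/
theorem len_mul_of_support_ge {n p : ℕ} (hp : p ≤ n) {w u : Grp n} (hw : act n w ∈ signed p)
    (hu : u ∈ sDot n) {e : ℕ → ℤ} (he : u = ogsProd n e n)
    (h : ∀ k, 1 ≤ k → k ≤ n → e k ≠ 0 → p ≤ k) : len n (w * u) = len n w + len n u := by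
  have hpos : ∀ a : ℤ, 0 < a → 0 < (act n u)⁻¹ a := fun a ha => by
    rw [← map_inv]
    exact act_pos_of_mem_sDot (inv_mem hu) ha
  rw [len_eq_inv, len_eq_inv, len_eq_inv, map_mul]
  refine inv_mul_of_minimal hp hw (act_mem_signed u) (fun a ha _ => hpos a ha) ?_
  intro a b ha hab hb
  have h1 : Circ ((act n u)⁻¹ a) ((act n u)⁻¹ b) := by
    rw [he]
    exact circ_ogsProd_inv le_rfl h (by rw [abs_le]; omega) (by rw [abs_le]; omega)
      (Or.inl ⟨ha, Or.inl hab⟩)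
  have h2 := hpos a ha
  have h3 := hpos b (by omega)
  unfold Circ at h1
  omega

theorem len_mul_tau_pow {n p : ℕ} (hp : p ≤ n) {w : Grp n} (hw : act n w ∈ signed p) :
    len n (w * tau n p ^ p) + len n w = len n (tau n p ^ p) := by
  rw [len_eq_inv, len_eq_inv, len_eq_inv, map_mul]
  refine inv_mul_eq hp hw ?_ fun z hz => act_tau_pow_self hp hz
  rw [map_pow]
  exact pow_mem (act_tau_mem_signed n p) _

theorem len_one (n : ℕ) : len n 1 = 0 := CoxeterSystem.length_one _

/-- The product `u_1 v_1 ⋯ u_j v_j`. -/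
def uvProd {n : ℕ} (u v : ℕ → Grp n) (j : ℕ) : Grp n :=
  ((List.range j).map fun j => u (j + 1) * v (j + 1)).prod

theorem uvProd_zero {n : ℕ} (u v : ℕ → Grp n) : uvProd u v 0 = 1 := rfl

theorem uvProd_succ {n : ℕ} (u v : ℕ → Grp n) (j : ℕ) :
    uvProd u v (j + 1) = uvProd u v j * (u (j + 1) * v (j + 1)) := by
  simp [uvProd, List.range_succ]

theorem uvProd_congr {n : ℕ} {u v u' v' : ℕ → Grp n} {j : ℕ}
    (h : ∀ k, 1 ≤ k → k ≤ j → u k = u' k ∧ v k = v' k) : uvProd u v j = uvProd u' v' j := by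
  induction j with
  | zero => rfl
  | succ j ih =>
    rw [uvProd_succ, uvProd_succ, ih fun k h1 h2 => h k h1 (by omega),
      (h (j + 1) (by omega) le_rfl).1, (h (j + 1) (by omega) le_rfl).2]

namespace IsUVForm

variable {n r : ℕ} {p : ℕ → ℕ} {u v : ℕ → Grp n} {w : Grp n}

theorem len_uvProd_mul_u (h : IsUVForm n r p u v w) {j : ℕ} (hj : j + 1 ≤ r)
    (hs : 1 ≤ j → act n (uvProd u v j) ∈ signed (p j)) :
    len n (uvProd u v j * u (j + 1)) = len n (uvProd u v j) + len n (u (j + 1)) := by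
  rcases Nat.eq_zero_or_pos j with rfl | hj0
  · simp [uvProd_zero, len_one]
  · obtain ⟨e, he, hsupp⟩ := h.u_supp (j + 1) (by omega) hj
    refine len_mul_of_support_ge (h.p_mem j hj0 (by omega)).2 (hs hj0)
      (h.u_mem _ (by omega) hj) he.2 fun k h1 h2 h3 => ?_
    exact (hsupp k h1 h2 h3).1 (by omega)

theorem act_uvProd_mem_signed (h : IsUVForm n r p u v w) {j : ℕ} (hj1 : 1 ≤ j) (hj : j < r) :
    act n (uvProd u v j) ∈ signed (p j) := by
  induction j, hj1 using Nat.le_induction with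
  | base =>
    obtain ⟨e, he, hsupp⟩ := h.u_supp 1 le_rfl hj.le
    rw [uvProd_succ, uvProd_zero, one_mul, map_mul, zero_add, h.v_eq 1 le_rfl hj, map_pow]
    refine mul_mem ?_ (pow_mem (act_tau_mem_signed n _) _)
    rw [he.2]
    exact act_ogsProd_mem_signed fun k h1 h2 h3 => (hsupp k h1 h2 h3).2 hj
  | succ j hj1 ih =>
    obtain ⟨e, he, hsupp⟩ := h.u_supp (j + 1) (by omega) hj.le
    rw [uvProd_succ, map_mul, map_mul, h.v_eq (j + 1) (by omega) hj, map_pow]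
    refine mul_mem (signed_mono (h.p_lt j (j + 1) hj1 (by omega) hj).le (ih (by omega)))
      (mul_mem ?_ (pow_mem (act_tau_mem_signed n _) _))
    rw [he.2]
    exact act_ogsProd_mem_signed fun k h1 h2 h3 => (hsupp k h1 h2 h3).2 hj

/-- The recursion is `ℓ(x u v) = ℓ(v) - ℓ(u) - ℓ(x)`, with `x` the product so far; its minus sign
before `ℓ(x)` causes the alternation. -/
theorem len_uvProd (h : IsUVForm n r p u v w) {j : ℕ} (hj : j < r) :
    (len n (uvProd u v j) : ℤ) = ∑ i ∈ Finset.Ico 1 (j + 1),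
      (-1 : ℤ) ^ (j - i) * ((len n (v i) : ℤ) - (len n (u i) : ℤ)) := by
  induction j with
  | zero => simp [uvProd_zero, len_one]
  | succ j ih =>
    have h1 := h.len_uvProd_mul_u hj.le fun h1 => h.act_uvProd_mem_signed h1 (by omega)
    have hs : act n (uvProd u v j * u (j + 1)) ∈ signed (p (j + 1)) := by
      have h2 := h.act_uvProd_mem_signed (j := j + 1) (by omega) hj
      have h3 : act n (tau n (p (j + 1)) ^ p (j + 1)) ∈ signed (p (j + 1)) := by
        rw [map_pow]
        exact pow_mem (act_tau_mem_signed n _) _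
      rw [uvProd_succ, ← mul_assoc, map_mul, h.v_eq (j + 1) (by omega) hj] at h2
      exact (Subgroup.mul_mem_cancel_right _ h3).mp h2
    have h2 := len_mul_tau_pow (h.p_mem (j + 1) (by omega) hj).2 hs
    rw [← h.v_eq (j + 1) (by omega) hj, mul_assoc, ← uvProd_succ, h1] at h2
    rw [Finset.sum_Ico_succ_top (by omega), Nat.sub_self, pow_zero, one_mul]
    have h4 : ∑ i ∈ Finset.Ico 1 (j + 1),
        (-1 : ℤ) ^ (j + 1 - i) * ((len n (v i) : ℤ) - (len n (u i) : ℤ)) =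
        -(len n (uvProd u v j) : ℤ) := by
      rw [ih (by omega), ← Finset.sum_neg_distrib]
      refine Finset.sum_congr rfl fun i hi => ?_
      rw [Finset.mem_Ico] at hi
      rw [show j + 1 - i = (j - i) + 1 by omega, pow_succ]
      ring
    rw [h4]
    omega

theorem len_eq (h : IsUVForm n r p u v w) :
    (len n w : ℤ) = ∑ i ∈ Finset.Ico 1 r,
      (-1 : ℤ) ^ (r - 1 - i) * ((len n (v i) : ℤ) - (len n (u i) : ℤ)) + (len n (u r) : ℤ) := by
  obtain ⟨j, rfl⟩ : ∃ j, r = j + 1 := ⟨r - 1, by have := h.one_le_r; omega⟩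
  rw [Nat.add_sub_cancel, ← h.len_uvProd (by omega)]
  have h1 := h.len_uvProd_mul_u le_rfl fun h1 => h.act_uvProd_mem_signed h1 (by omega)
  have h2 : w = uvProd u v j * u (j + 1) := h.prod_eq
  rw [h2, h1]
  push_cast
  rfl

end IsUVForm

/-! ### Existence of the factorization -/

theorem exists_ogsProd {n m : ℕ} (hm : m ≤ n) {g : Equiv.Perm ℤ} (hg : g ∈ signed m) :
    ∃ e : ℕ → ℤ, (∀ k : ℕ, 1 ≤ k → -(k : ℤ) ≤ e k ∧ e k < k) ∧ act n (ogsProd n e m) = g := by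
  induction m generalizing g with
  | zero =>
    refine ⟨0, fun k hk => by simp only [Pi.zero_apply]; omega, ?_⟩
    rw [ogsProd_zero, map_one]
    ext z
    rw [Equiv.Perm.one_apply]
    by_cases hz : z = 0
    · rw [hz, signed_zero hg]
    · rw [signed_fix hg (by simpa using hz)]
  | succ m ih =>
    have hs := act_tau_mem_signed n (m + 1)
    -- The `2(m + 1)` rotations reach every point of the circle, so one of them takes `m + 1` to
    -- `g⁻¹ (m + 1)`. Removing it from `g` leaves a permutation fixing `m + 1`.
    obtain ⟨c, hc1, hc2, hc⟩ : ∃ c : ℤ, -((m + 1 : ℕ) : ℤ) ≤ c ∧ c < (m + 1 : ℕ) ∧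
        g (act n (tau n (m + 1) ^ (-c)) (m + 1)) = m + 1 := by
      have hy : |g⁻¹ (m + 1)| ≤ (m + 1 : ℕ) :=
        signed_abs_le (inv_mem hg) (by rw [abs_le]; push_cast; omega)
      have hy0 : g⁻¹ (m + 1) ≠ 0 := signed_ne_zero (inv_mem hg) (by omega)
      obtain ⟨y, hyy⟩ : ∃ y, g⁻¹ (m + 1) = y := ⟨_, rfl⟩
      have hgy : g y = m + 1 := by
        rw [← hyy, ← Equiv.Perm.mul_apply, mul_inv_cancel, Equiv.Perm.one_apply]
      rw [hyy, abs_le] at hy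
      rw [hyy] at hy0
      push_cast at hy
      rcases lt_or_gt_of_ne hy0 with h | h
      · obtain ⟨a, rfl⟩ : ∃ a : ℕ, y = -a := ⟨y.natAbs, by omega⟩
        refine ⟨-a, by push_cast; omega, by push_cast; omega, ?_⟩
        rw [neg_neg, zpow_natCast, act_tau_pow (by omega) hm (by omega) (by omega)
          (by push_cast; omega), if_neg (by push_cast; omega)]
        convert hgy using 2
        push_cast
        ring
      · obtain ⟨a, ha⟩ : ∃ a : ℕ, (m : ℤ) + 1 - y = a := ⟨(m + 1 - y).toNat, by omega⟩
        refine ⟨a, by omega, by push_cast; omega, ?_⟩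
        convert hgy using 2
        rw [zpow_neg, map_inv, Equiv.Perm.inv_eq_iff_eq, zpow_natCast,
          act_tau_pow (by omega) hm (by omega) h (by push_cast; omega),
          if_pos (by push_cast; omega)]
        omega
    have hg1 : g * act n (tau n (m + 1) ^ (-c)) ∈ signed (m + 1) := by
      rw [map_zpow]
      exact mul_mem hg (zpow_mem hs _)
    have hg' : g * act n (tau n (m + 1) ^ (-c)) ∈ signed m := by
      refine ⟨hg1.1, fun z hz => ?_⟩
      by_cases h1 : ((m + 1 : ℕ) : ℤ) < |z|
      · exact hg1.2 z h1
      · have h2 : z = m + 1 ∨ z = -(m + 1) := by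
          push_cast at h1
          rcases abs_cases z with h | h <;> omega
        rcases h2 with rfl | rfl
        · exact hc
        · rw [hg1.1, Equiv.Perm.mul_apply, hc]
    obtain ⟨e, he, hprod⟩ := ih (by omega) hg'
    refine ⟨Function.update e (m + 1) c, fun k hk => ?_, ?_⟩
    · by_cases hkm : k = m + 1
      · subst hkm
        rw [Function.update_self]
        exact ⟨hc1, hc2⟩
      · rw [Function.update_of_ne hkm]
        exact he k hk
    · rw [ogsProd_succ, Function.update_self, ogsProd_congr n (f := e) fun k h1 h2 =>
        Function.update_of_ne (by omega) _ _, map_mul, hprod, mul_assoc, ← map_mul, ← zpow_add]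
      simp

/-- All conditions of `IsUVForm` that do not involve the last factor `u_r`, with the bound `m` for
the indices. -/
structure IsUVPrefix (n m r : ℕ) (p : ℕ → ℕ) (u : ℕ → Grp n) : Prop where
  one_le_r : 1 ≤ r
  p_mem : ∀ j, 1 ≤ j → j < r → 1 ≤ p j ∧ p j ≤ m
  p_lt : ∀ i j, 1 ≤ i → i < j → j < r → p i < p j
  u_mem : ∀ j, 1 ≤ j → j < r → u j ∈ sDot n
  u_supp : ∀ j, 1 ≤ j → j < r → ∃ e : ℕ → ℤ, IsOGS n e (u j) ∧
    ∀ k, 1 ≤ k → k ≤ n → e k ≠ 0 → (2 ≤ j → p (j - 1) ≤ k) ∧ k ≤ p j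

theorem IsUVPrefix.snoc {n m r : ℕ} {p : ℕ → ℕ} {u : ℕ → Grp n} (h : IsUVPrefix n m r p u)
    {x : Grp n} (hx : x ∈ sDot n) {e : ℕ → ℤ} (he : IsOGS n e x)
    (hsupp : ∀ k, 1 ≤ k → k ≤ n → e k ≠ 0 → (2 ≤ r → p (r - 1) ≤ k) ∧ k ≤ m + 1) :
    IsUVPrefix n (m + 1) (r + 1) (Function.update p r (m + 1)) (Function.update u r x) where
  one_le_r := by omega
  p_mem j h1 h2 := by
    by_cases hj : j = r
    · subst hj
      rw [Function.update_self]
      omega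
    · rw [Function.update_of_ne hj]
      have := h.p_mem j h1 (by omega)
      omega
  p_lt i j h1 h2 h3 := by
    rw [Function.update_of_ne (by omega : i ≠ r)]
    by_cases hj : j = r
    · subst hj
      rw [Function.update_self]
      have := h.p_mem i h1 (by omega)
      omega
    · rw [Function.update_of_ne hj]
      exact h.p_lt i j h1 h2 (by omega)
  u_mem j h1 h2 := by
    by_cases hj : j = r
    · subst hj
      rwa [Function.update_self]
    · rw [Function.update_of_ne hj]
      exact h.u_mem j h1 (by omega)
  u_supp j h1 h2 := by
    rw [Function.update_of_ne (by omega : j - 1 ≠ r)]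
    by_cases hj : j = r
    · subst hj
      rw [Function.update_self, Function.update_self]
      exact ⟨e, he, hsupp⟩
    · rw [Function.update_of_ne hj, Function.update_of_ne hj]
      exact h.u_supp j h1 (by omega)

/-- The last block need not lie in `Ṡ_n` yet. The parameter `c` prescribes the power of `τ_m` that
must bring it there, as dictated by the later exponents; at the top `c = 0`. -/
theorem exists_isUVPrefix {n m : ℕ} (hm : m ≤ n) (e : ℕ → ℤ)
    {c : ℕ} (hc : c ≤ m) :
    ∃ (r : ℕ) (p : ℕ → ℕ) (u : ℕ → Grp n) (f : ℕ → ℤ), IsUVPrefix n m r p u ∧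
      (∀ k : ℕ, 1 ≤ k → -(k : ℤ) ≤ f k ∧ f k < k) ∧
      (∀ k, f k ≠ 0 → k ≤ m ∧ (2 ≤ r → p (r - 1) ≤ k)) ∧
      ogsProd n f n * tau n m ^ c ∈ sDot n ∧
      ogsProd n e m = uvProd u (fun j => tau n (p j) ^ p j) (r - 1) * ogsProd n f n := by
  induction m generalizing c with
  | zero =>
    obtain rfl : c = 0 := by omega
    refine ⟨1, 0, 1, 0, ⟨le_rfl, by omega, by omega, by omega, by omega⟩, ?_, ?_, ?_, ?_⟩
    · intro k hk
      simp only [Pi.zero_apply]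
      omega
    · intro k hk
      exact absurd rfl hk
    · rw [ogsProd_eq_one n (e := 0) fun _ _ _ => rfl, pow_zero, one_mul]
      exact one_mem _
    · rw [ogsProd_zero, Nat.sub_self, uvProd_zero, one_mul,
        ogsProd_eq_one n (e := 0) fun _ _ _ => rfl]
  | succ m ih =>
    have hM : (0 : ℤ) < (m + 1 : ℕ) := by push_cast; omega
    -- Write `e (m + 1) = a + (m + 1) q - c` with `0 ≤ a ≤ m`. The remainder `a` is the correction
    -- demanded of the previous stage, and only the parity of `q` matters because `τ_{m+1}` has
    -- order dividing `2(m + 1)`.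
    obtain ⟨a, ha⟩ : ∃ a : ℕ, (e (m + 1) + c) % (m + 1 : ℕ) = a :=
      ⟨((e (m + 1) + c) % (m + 1 : ℕ)).toNat,
        (Int.toNat_of_nonneg (Int.emod_nonneg _ hM.ne')).symm⟩
    have ham : a ≤ m := by
      have := Int.emod_lt_of_pos (e (m + 1) + c) hM
      rw [ha] at this
      omega
    obtain ⟨r, p, u, f, hpre, hf, hsupp, hmem, hprod⟩ := ih (by omega) ham
    have hr := hpre.one_le_r
    have hdiv : e (m + 1) = a + (m + 1 : ℕ) * ((e (m + 1) + c) / (m + 1 : ℕ)) - c := by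
      have := Int.emod_add_mul_ediv (e (m + 1) + c) (m + 1 : ℕ)
      rw [ha] at this
      omega
    have htau : tau n (m + 1) ^ (2 * (m + 1 : ℕ) : ℤ) = 1 := by
      have := tau_pow_two_mul (n := n) hm
      rw [← zpow_natCast] at this
      push_cast at this ⊢
      exact this
    have hf0 : ∀ k, m < k → f k = 0 := fun k hk => by
      by_contra hne
      have := (hsupp k hne).1
      omega
    have hupd : ∀ d : ℤ, ogsProd n (Function.update f (m + 1) d) n =
        ogsProd n f n * tau n (m + 1) ^ d := by
      intro d
      rw [ogsProd_eq_of_le n hm fun k h1 _ => by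
          rw [Function.update_of_ne (by omega), hf0 k (by omega)],
        ogsProd_succ, Function.update_self, ogsProd_eq_of_le n (by omega : m ≤ n) fun k h1 _ =>
          hf0 k h1]
      congr 1
      exact ogsProd_congr n fun k _ h2 => Function.update_of_ne (by omega) _ _
    have hfb : ∀ d : ℤ, -((m + 1 : ℕ) : ℤ) ≤ d → d < (m + 1 : ℕ) → ∀ k : ℕ, 1 ≤ k →
        -(k : ℤ) ≤ Function.update f (m + 1) d k ∧ Function.update f (m + 1) d k < k := by
      intro d h1 h2 k hk
      by_cases hkm : k = m + 1
      · subst hkm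
        rw [Function.update_self]
        exact ⟨h1, h2⟩
      · rw [Function.update_of_ne hkm]
        exact hf k hk
    have hfs : ∀ d : ℤ, ∀ k, Function.update f (m + 1) d k ≠ 0 →
        k ≤ m + 1 ∧ (2 ≤ r → p (r - 1) ≤ k) := by
      intro d k hk
      by_cases hkm : k = m + 1
      · refine ⟨hkm.le, fun h2 => ?_⟩
        have := (hpre.p_mem (r - 1) (by omega) (by omega)).2
        omega
      · rw [Function.update_of_ne hkm] at hk
        exact ⟨(hsupp k hk).1.trans (by omega), (hsupp k hk).2⟩
    -- The correction by `τ_m ^ a` may be replaced by `τ_{m+1} ^ a`, since the two differ by an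
    -- element of `Ṡ_n`.
    have hx : ogsProd n f n * tau n (m + 1) ^ (a : ℤ) ∈ sDot n := by
      have := mul_mem hmem (tau_zpow_neg_mul_mem_sDot hm ham)
      rwa [mul_assoc, mul_inv_cancel_left, ← zpow_natCast (tau n (m + 1))] at this
    rcases Int.even_or_odd' ((e (m + 1) + c) / (m + 1 : ℕ)) with ⟨t, ht | ht⟩
    -- Even quotient: `τ_{m+1} ^ (a - c)` joins the current block, and multiplying by `τ_{m+1} ^ c`
    -- leaves the corrected block.
    · have hpow : tau n (m + 1) ^ e (m + 1) = tau n (m + 1) ^ ((a : ℤ) - c) := by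
        rw [hdiv, ht, show (a : ℤ) + (m + 1 : ℕ) * (2 * t) - c =
          (a - c) + (2 * (m + 1 : ℕ)) * t by ring, zpow_add, zpow_mul, htau, one_zpow, mul_one]
      refine ⟨r, p, u, Function.update f (m + 1) (a - c),
        ⟨hr, fun j h1 h2 => ?_, hpre.p_lt, hpre.u_mem, hpre.u_supp⟩,
        hfb _ (by push_cast; omega) (by push_cast; omega), hfs _, ?_, ?_⟩
      · have := hpre.p_mem j h1 h2
        omega
      · rw [hupd, mul_assoc, ← zpow_natCast, ← zpow_add, sub_add_cancel]
        exact hx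
      · rw [ogsProd_succ, hprod, hupd, hpow, mul_assoc]
    -- Odd quotient: `τ_{m+1} ^ a` completes the block, the middle factor becomes a new `v`, and
    -- `τ_{m+1} ^ (-c)` starts the next block.
    · have hpow : tau n (m + 1) ^ e (m + 1) =
          tau n (m + 1) ^ (a : ℤ) * tau n (m + 1) ^ (m + 1) * tau n (m + 1) ^ (-c : ℤ) := by
        rw [← zpow_natCast _ (m + 1), ← zpow_add, ← zpow_add]
        rw [hdiv, ht, show (a : ℤ) + (m + 1 : ℕ) * (2 * t + 1) - c =
          (a + (m + 1 : ℕ) + -c) + (2 * (m + 1 : ℕ)) * t by ring, zpow_add, zpow_mul, htau,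
          one_zpow, mul_one]
      have hsnoc := hpre.snoc hx (e := Function.update f (m + 1) a)
        ⟨fun k h1 _ => hfb a (by push_cast; omega) (by push_cast; omega) k h1, (hupd a).symm⟩
        fun k _ _ h3 => ⟨(hfs a k h3).2, (hfs a k h3).1⟩
      have hg : ogsProd n (Function.update 0 (m + 1) (-c : ℤ)) n = tau n (m + 1) ^ (-c : ℤ) := by
        rw [ogsProd_eq_of_le n hm fun k h1 _ => by
            rw [Function.update_of_ne (by omega), Pi.zero_apply],
          ogsProd_succ, Function.update_self, ogsProd_eq_one n fun k _ h2 => by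
            rw [Function.update_of_ne (by omega), Pi.zero_apply], one_mul]
      refine ⟨r + 1, Function.update p r (m + 1), Function.update u r
        (ogsProd n f n * tau n (m + 1) ^ (a : ℤ)), Function.update 0 (m + 1) (-c), hsnoc,
        fun k hk => ?_, fun k hk => ?_, ?_, ?_⟩
      · by_cases hkm : k = m + 1
        · subst hkm
          rw [Function.update_self]
          push_cast
          omega
        · rw [Function.update_of_ne hkm, Pi.zero_apply]
          omega
      · have hkm : k = m + 1 := by
          by_contra hkm
          exact hk (by rw [Function.update_of_ne hkm, Pi.zero_apply])
        refine ⟨hkm.le, fun _ => ?_⟩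
        rw [Nat.add_sub_cancel, Function.update_self, hkm]
      · rw [hg, ← zpow_natCast, ← zpow_add, neg_add_cancel, zpow_zero]
        exact one_mem _
      · obtain ⟨q, rfl⟩ : ∃ q, r = q + 1 := ⟨r - 1, by omega⟩
        rw [ogsProd_succ, hprod, hg, hpow, Nat.add_sub_cancel, Nat.add_sub_cancel, uvProd_succ,
          Function.update_self, Function.update_self]
        rw [uvProd_congr (u := Function.update u _ _) (u' := u)
          (v' := fun j => tau n (p j) ^ p j) fun k h1 h2 => by
            simp only [Function.update_of_ne (by omega : k ≠ q + 1), and_self]]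
        simp only [mul_assoc]

theorem exists_isUVForm {n : ℕ} (w : Grp n) :
    ∃ (r : ℕ) (p : ℕ → ℕ) (u v : ℕ → Grp n), IsUVForm n r p u v w := by
  obtain ⟨e, -, he⟩ := exists_ogsProd le_rfl (act_mem_signed w)
  have hw := act_injective n he
  obtain ⟨r, p, u, f, hpre, hf, hsupp, hmem, hprod⟩ :=
    exists_isUVPrefix le_rfl e (Nat.zero_le n)
  rw [pow_zero, mul_one] at hmem
  have hr := hpre.one_le_r
  refine ⟨r, p, Function.update u r (ogsProd n f n), fun j => tau n (p j) ^ p j, hr, hpre.p_mem,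
    hpre.p_lt, fun _ _ _ => rfl, fun j h1 h2 => ?_, fun j h1 h2 => ?_, ?_⟩
  · by_cases hj : j = r
    · subst hj
      rwa [Function.update_self]
    · rw [Function.update_of_ne hj]
      exact hpre.u_mem j h1 (by omega)
  · by_cases hj : j = r
    · subst hj
      rw [Function.update_self]
      exact ⟨f, ⟨fun k h1 _ => hf k h1, rfl⟩,
        fun k _ _ h3 => ⟨(hsupp k h3).2, fun h => absurd h (lt_irrefl _)⟩⟩
    · rw [Function.update_of_ne hj]
      obtain ⟨e', he', hs⟩ := hpre.u_supp j h1 (by omega)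
      exact ⟨e', he', fun k h3 h4 h5 => ⟨(hs k h3 h4 h5).1, fun _ => (hs k h3 h4 h5).2⟩⟩
  · rw [Function.update_self, ← hw, hprod]
    congr 1
    exact uvProd_congr fun k h1 h2 =>
      ⟨(Function.update_of_ne (by omega : k ≠ r) _ _).symm, rfl⟩

end TypeB

theorem mainTheorem8 (n : ℕ) (w : TypeB.Grp n) :
    (∃ (r : ℕ) (p : ℕ → ℕ) (u v : ℕ → TypeB.Grp n), TypeB.IsUVForm n r p u v w) ∧
    ∀ (r : ℕ) (p : ℕ → ℕ) (u v : ℕ → TypeB.Grp n), TypeB.IsUVForm n r p u v w →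
      (TypeB.len n w : ℤ) =
        ∑ i ∈ Finset.Ico 1 r,
          (-1 : ℤ) ^ (r - 1 - i) * ((TypeB.len n (v i) : ℤ) - (TypeB.len n (u i) : ℤ))
        + (TypeB.len n (u r) : ℤ) :=
  ⟨TypeB.exists_isUVForm w, fun _ _ _ _ h => h.len_eq⟩
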